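/- Let $G$ be a finite simple graph of order $n\ge 2$. Suppose that for some real $\varepsilon>0$ the graph $G$ is $(1+\varepsilon)$-tough, i.e. for every integer $p\ge 2$ and every set $S$ of vertices such that $G-S$ has exactly $p$ connected components one has $|S|\ge(1+\varepsilon)p$. Suppose also that $G$ is $5$-chordal, i.e. every cycle of length at least $5$ in $G$ has a chord. Let $$\delta_3(G):=\min\{d(x_1)+d(x_2)+d(x_3) : x_1,x_2,x_3 \text{ distinct, pairwise non-adjacent vertices of } G\},$$ with $\delta_3(G)=\infty$ if there are no three such vertices. If $\delta_3(G)\ge n+2$, then $G$ is prism-Hamiltonian, i.e. the Cartesian product $G\,\square\,K_2$ has a Hamiltonian cycle. -/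

import Mathlib

namespace SimpleGraph

variable {V : Type*}

/-- `G` is `β`-tough: for every `p ≥ 2`, deleting a set `S` of vertices that leaves exactly `p`
connected components requires `|S| ≥ β * p`. -/
def IsTough (G : SimpleGraph V) (β : ℝ) : Prop :=
  ∀ S : Finset V, ∀ p : ℕ, 2 ≤ p →
    Nat.card (G.induce ((S : Set V)ᶜ)).ConnectedComponent = p → β * (p : ℝ) ≤ (S.card : ℝ)

/-- `G` is `k`-chordal: every cycle of length at least `k` has a chord. -/
def IsKChordal (G : SimpleGraph V) (k : ℕ) : Prop :=
  ∀ (v : V) (c : G.Walk v v), c.IsCycle → k ≤ c.length → ∃ e : Sym2 V, c.IsChord e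

/-- `δ₃(G)`: the minimum degree sum of three pairwise distinct, pairwise nonadjacent vertices
(`⊤` if there are no three such vertices). -/
noncomputable def deltaThree (G : SimpleGraph V) [Fintype V] [DecidableRel G.Adj] : ℕ∞ :=
  ⨅ (s : Finset V) (_ : G.IsNIndepSet 3 s), ((∑ v ∈ s, G.degree v : ℕ) : ℕ∞)

/-- The prism over `G`: the Cartesian product of `G` with the complete graph `K₂`. -/
def prism (G : SimpleGraph V) : SimpleGraph (V × Fin 2) :=
  G □ (⊤ : SimpleGraph (Fin 2))

/-- `G` is prism-Hamiltonian if the prism over `G` has a Hamiltonian cycle. -/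
def IsPrismHamiltonian (G : SimpleGraph V) [Fintype V] [DecidableEq V] : Prop :=
  G.prism.IsHamiltonian

end SimpleGraph

/-! Suppose an even closed walk without repeated vertices (a cycle or an edge) is such that the
remaining vertices split into paths hanging at distinct vertices of the walk. Running out along each
hanging path in one layer and back in the other switches layers once per root, so by evenness the
tour closes to a Hamiltonian cycle of the prism (`isPrismHamiltonian_of_hung_paths`).

Take a longest cycle `c`, of length `m`. Toughness enters only through the bound
`IsTough.three_le_card` on separators. If `u u'` were an edge off `c`, the component of `u'` outside
`c` and `u` would be attached to `c` at two or more vertices. The successors of two attachments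
together with `u` are independent, and exchange arguments bound their degree sum by `n + 1`. Hence
the vertices off `c` are independent (`not_adj_of_off`). They have degree at least 3, and at most
`(m + 1) / 2` because none has two consecutive neighbours on `c`.

If `m` is even, the bound on `δ₃` gives every vertex off `c` at least as many neighbours as there
are such vertices; Hall's theorem hangs them one by one at distinct vertices of `c`. If `m` is odd,
the neighbours of a vertex `x` off `c` leave an odd gap (`exists_odd_gap`). Replacing that gap by
`x` gives an even cycle `x, c 0, …, c p`; the vertices inside the gap form a hanging path, and the
others off `c` are matched to `c 0, …, c (p - 1)`. Should the matching fail, there is just one other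
vertex, and it extends a piece of the gap (`isPrismHamiltonian_of_cut`). -/

namespace SimpleGraph

variable {V : Type*} {G : SimpleGraph V}

/-! ### Paths given as lists of vertices -/

/-- The list `l` is the sequence of vertices of a walk in `G` from `a` to `b`. -/
structure IsListWalk (G : SimpleGraph V) (a b : V) (l : List V) : Prop where
  chain : l.IsChain G.Adj
  head : l.head? = some a
  last : l.getLast? = some b

namespace IsListWalk

variable {a b c d : V} {l l' : List V}

theorem singleton (a : V) : G.IsListWalk a a [a] := ⟨by simp, rfl, rfl⟩

theorem ne_nil (h : G.IsListWalk a b l) : l ≠ [] := by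
  rintro rfl
  simpa using h.head

theorem length_pos (h : G.IsListWalk a b l) : 0 < l.length :=
  List.length_pos_iff.2 h.ne_nil

theorem append (h : G.IsListWalk a b l) (h' : G.IsListWalk c d l') (hbc : G.Adj b c) :
    G.IsListWalk a d (l ++ l') where
  chain := h.chain.append h'.chain (by
    rw [h.last, h'.head]
    rintro x ⟨⟩ y ⟨⟩
    exact hbc)
  head := by simp [h.head]
  last := by simp [List.getLast?_append, h'.last]

theorem cons (h : G.IsListWalk c d l) (hac : G.Adj a c) : G.IsListWalk a d (a :: l) :=
  (singleton a).append h hac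

theorem concat (h : G.IsListWalk a b l) (hbc : G.Adj b c) : G.IsListWalk a c (l ++ [c]) :=
  h.append (singleton c) hbc

theorem reverse (h : G.IsListWalk a b l) : G.IsListWalk b a l.reverse where
  chain := by
    rw [List.isChain_reverse]
    exact h.chain.imp fun _ _ hxy => hxy.symm
  head := by simp [h.last]
  last := by simp [h.head]

theorem exists_walk (h : G.IsListWalk a b l) : ∃ p : G.Walk a b, p.support = l := by
  have h1 : l.head h.ne_nil = a := by
    have := h.head
    rw [List.head?_eq_some_head h.ne_nil] at this
    simpa using this
  have h2 : l.getLast h.ne_nil = b := by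
    have := h.last
    rw [List.getLast?_eq_some_getLast h.ne_nil] at this
    simpa using this
  exact ⟨(Walk.ofSupport l h.ne_nil h.chain).copy h1 h2, by simp⟩

end IsListWalk

theorem Walk.isListWalk_support {a b : V} (p : G.Walk a b) : G.IsListWalk a b p.support where
  chain := p.isChain_adj_support
  head := by rw [List.head?_eq_some_head p.support_ne_nil, p.head_support]
  last := by rw [List.getLast?_eq_some_getLast p.support_ne_nil, p.getLast_support]

theorem IsListWalk.isHamiltonian [Fintype V] [DecidableEq V] {a b : V} {l : List V}
    (h : G.IsListWalk a b l) (hba : G.Adj b a) (hn : l.Nodup) (hlen : 3 ≤ l.length)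
    (hcov : ∀ v, v ∈ l) : G.IsHamiltonian := by
  -- `IsHamiltonian` exempts graphs on one vertex; the cycle is constructed without that case
  -- distinction.
  intro _
  obtain ⟨p, rfl⟩ := h.exists_walk
  refine ⟨b, Walk.cons hba p, ?_⟩
  rw [Walk.isHamiltonianCycle_iff_isCycle_and_support_count_tail_eq_one]
  refine ⟨Walk.isCycle_iff_isPath_tail_and_le_length.2 ⟨?_, ?_⟩, fun v => ?_⟩
  · simpa [Walk.isPath_def] using hn
  · simp only [Walk.length_support] at hlen
    simp only [Walk.length_cons]
    omega
  · simpa using List.count_eq_one_of_mem hn (hcov v)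

/-! ### Hamiltonian cycles in prisms -/

/-- The tour of a prism which, for each root `v` of the list in turn, runs along the path
`v :: F v` in one layer and comes back in the other layer, starting in layer `i`. -/
def prismTour (F : V → List V) : Fin 2 → List V → List (V × Fin 2)
  | _, [] => []
  | i, v :: L => ((v :: F v).map (·, i) ++ ((v :: F v).map (·, i + 1)).reverse) ++
      prismTour F (i + 1) L

theorem IsListWalk.map_layer {a b : V} {l : List V} (h : G.IsListWalk a b l) (i : Fin 2) :
    G.prism.IsListWalk (a, i) (b, i) (l.map (·, i)) where
  chain := List.isChain_map_of_isChain (·, i) (fun _ _ hab => boxProd_adj_left.2 hab) h.chain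
  head := by simp [h.head]
  last := by simp [h.last]

theorem prism_adj_flip (v : V) (i : Fin 2) : G.prism.Adj (v, i) (v, i + 1) := by
  refine boxProd_adj_right.2 ?_
  fin_cases i <;> simp

/-- Each block starts and ends at its root but in opposite layers, so the final layer depends only
on the parity of the number of roots. -/
theorem isListWalk_prismTour {F : V → List V} (L : List V) :
    ∀ {a b : V} (i : Fin 2), G.IsListWalk a b L → (∀ v ∈ L, (v :: F v).IsChain G.Adj) →
      G.prism.IsListWalk (a, i) (b, i + L.length • 1) (prismTour F i L) := by
  induction L with
  | nil => intro a b i h; exact absurd rfl h.ne_nil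
  | cons v L ih =>
    intro a b i h hF
    obtain rfl : v = a := by simpa using h.head
    have hv : G.IsListWalk v ((v :: F v).getLast (by simp)) (v :: F v) :=
      ⟨hF v (by simp), rfl, List.getLast?_eq_some_getLast _⟩
    have hblock : G.prism.IsListWalk (v, i) (v, i + 1)
        ((v :: F v).map (·, i) ++ ((v :: F v).map (·, i + 1)).reverse) :=
      (hv.map_layer i).append (hv.map_layer (i + 1)).reverse (prism_adj_flip _ i)
    cases L with
    | nil =>
      obtain rfl : v = b := by simpa using h.last
      simpa [prismTour] using hblock
    | cons w L =>
      have hvw : G.Adj v w := h.chain.rel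
      have hL : G.IsListWalk w b (w :: L) :=
        ⟨h.chain.tail, rfl, by simpa [List.getLast?_cons_cons] using h.last⟩
      have := hblock.append (ih (i + 1) hL fun u hu => hF u (List.mem_cons_of_mem _ hu))
        (boxProd_adj_left.2 hvw)
      have e : i + 1 + (w :: L).length • 1 = i + (v :: w :: L).length • 1 := by
        rw [List.length_cons (a := v), succ_nsmul']
        exact add_assoc _ _ _
      rw [e] at this
      exact this

/-- A block passes through its path once in each layer. Counting yields at once that the tour
repeats no vertex and that it misses none. -/
theorem count_prismTour [DecidableEq V] {F : V → List V} (L : List V) (i j : Fin 2) (z : V) :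
    (prismTour F i L).count (z, j) = (L.flatMap fun v => v :: F v).count z := by
  have key : ∀ (l : List V) (i : Fin 2), (l.map (·, i)).count (z, j) =
      if i = j then l.count z else 0 := by
    intro l i
    split_ifs with h
    · subst h
      exact List.count_map_of_injective l (fun z : V => (z, i)) (fun a b h => by simpa using h) z
    · rw [List.count_eq_zero]
      simp only [List.mem_map, Prod.mk.injEq, not_exists, not_and]
      exact fun _ _ _ h' => h h'
  induction L generalizing i with
  | nil => rfl
  | cons v L ih =>
    simp only [prismTour, List.count_append, List.count_reverse, key, ih, List.flatMap_cons]
    have : (i = j ∧ i + 1 ≠ j) ∨ (i ≠ j ∧ i + 1 = j) := by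
      fin_cases i <;> fin_cases j <;> simp
    rcases this with ⟨h1, h2⟩ | ⟨h1, h2⟩ <;> simp [h1, h2]

theorem two_mul_length_le_length_prismTour (F : V → List V) (L : List V) (i : Fin 2) :
    2 * L.length ≤ (prismTour F i L).length := by
  induction L generalizing i with
  | nil => simp
  | cons v L ih =>
    have := ih (i + 1)
    simp only [prismTour, List.length_append, List.length_reverse, List.length_map,
      List.length_cons]
    omega

/-- A graph with an even closed walk without repeated vertices (a cycle or an edge) such that the
remaining vertices can be partitioned into paths hanging at distinct vertices of the walk is
prism-Hamiltonian. -/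
theorem isPrismHamiltonian_of_hung_paths [Fintype V] [DecidableEq V] {a b : V} {L : List V}
    (hL : G.IsListWalk a b L) (hba : G.Adj b a) (hn : L.Nodup) (heven : Even L.length)
    {F : V → List V} (hchain : ∀ v ∈ L, (v :: F v).IsChain G.Adj)
    (hnF : ∀ v ∈ L, (F v).Nodup) (hFL : ∀ v ∈ L, ∀ z ∈ F v, z ∉ L)
    (hFF : ∀ v ∈ L, ∀ w ∈ L, ∀ z ∈ F v, z ∈ F w → v = w)
    (hcov : ∀ z, z ∈ L ∨ ∃ v ∈ L, z ∈ F v) : G.IsPrismHamiltonian := by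
  have hnod : (L.flatMap fun v => v :: F v).Nodup := by
    rw [List.nodup_flatMap]
    refine ⟨fun v hv => List.nodup_cons.2 ⟨fun h => hFL v hv v h hv, hnF v hv⟩, ?_⟩
    refine hn.pairwise_of_forall_ne fun v hv w hw hvw => ?_
    intro z hz hz'
    rcases List.mem_cons.1 hz with rfl | hz <;> rcases List.mem_cons.1 hz' with rfl | hz'
    · exact hvw rfl
    · exact hFL w hw _ hz' hv
    · exact hFL v hv _ hz hw
    · exact hvw (hFF v hv w hw z hz hz')
  have hlen : 2 ≤ L.length := by
    have := hL.length_pos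
    obtain ⟨k, hk⟩ := heven
    omega
  have hl0 : L.length • (1 : Fin 2) = 0 := by
    obtain ⟨k, hk⟩ := heven
    rw [hk, add_nsmul]
    generalize k • (1 : Fin 2) = x
    fin_cases x <;> rfl
  have hwalk := isListWalk_prismTour L 0 hL hchain
  rw [hl0] at hwalk
  refine hwalk.isHamiltonian (boxProd_adj_left.2 hba) ?_ ?_ ?_
  · rw [List.nodup_iff_count_le_one]
    rintro ⟨z, j⟩
    rw [count_prismTour]
    exact List.nodup_iff_count_le_one.1 hnod z
  · have := two_mul_length_le_length_prismTour F L 0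
    omega
  · rintro ⟨z, j⟩
    rw [← List.count_pos_iff, count_prismTour, List.count_pos_iff, List.mem_flatMap]
    rcases hcov z with hz | ⟨v, hv, hz⟩
    · exact ⟨z, hz, by simp⟩
    · exact ⟨v, hv, by simp [hz]⟩

/-! ### Longest cycles -/

/-- The `k` consecutive values of the sequence `c` that begin with `c a`. -/
def seg (c : ℕ → V) (a k : ℕ) : List V := (List.range' a k).map c

@[simp] theorem length_seg (c : ℕ → V) (a k : ℕ) : (seg c a k).length = k := by simp [seg]

theorem mem_seg {c : ℕ → V} {a k : ℕ} {v : V} :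
    v ∈ seg c a k ↔ ∃ i, a ≤ i ∧ i < a + k ∧ c i = v := by
  simp [seg, List.mem_range'_1, and_assoc]

theorem seg_append (c : ℕ → V) (a k l : ℕ) : seg c a k ++ seg c (a + k) l = seg c a (k + l) := by
  simp [seg, ← List.map_append, List.range'_append_1]

theorem seg_succ (c : ℕ → V) (a k : ℕ) : seg c a (k + 1) = c a :: seg c (a + 1) k := by
  simp [seg, List.range'_succ]

theorem isListWalk_seg {c : ℕ → V} (hc : ∀ i, G.Adj (c i) (c (i + 1))) {a b k : ℕ}
    (h : b + 1 = a + k) (hk : 0 < k) : G.IsListWalk (c a) (c b) (seg c a k) := by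
  obtain ⟨k, rfl⟩ : ∃ l, k = l + 1 := ⟨k - 1, by omega⟩
  obtain rfl : b = a + k := by omega
  induction k generalizing a with
  | zero => exact IsListWalk.singleton _
  | succ k ih =>
    rw [seg_succ]
    have := (ih (a := a + 1) (by omega) (by omega)).cons (hc a)
    rwa [show a + 1 + k = a + (k + 1) by ring] at this

/-- The sequence `c` runs around, with period `m`, a longest cycle of `G` (where an edge counts
as a cycle of length two). -/
structure IsLongestCycle (G : SimpleGraph V) (c : ℕ → V) (m : ℕ) : Prop where
  two_le : 2 ≤ m
  periodic : ∀ i, c (i + m) = c i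
  inj : ∀ i j, i < j → j < i + m → c i ≠ c j
  adj : ∀ i, G.Adj (c i) (c (i + 1))
  max : ∀ a b l, G.IsListWalk a b l → G.Adj b a → l.Nodup → l.length ≤ m

theorem exists_isLongestCycle [Fintype V] {v w : V} (hvw : G.Adj v w) :
    ∃ c m, G.IsLongestCycle c m := by
  classical
  let P : ℕ → Prop := fun k => ∃ a b l, G.IsListWalk a b l ∧ G.Adj b a ∧ l.Nodup ∧ l.length = k
  have hb : ∀ k, P k → k ≤ Fintype.card V := by
    rintro k ⟨a, b, l, -, -, hn, rfl⟩
    exact hn.length_le_card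
  have h2 : P 2 := ⟨v, w, [v, w], (IsListWalk.singleton w).cons hvw, hvw.symm,
    by simpa using hvw.ne, rfl⟩
  set m := Nat.findGreatest P (Fintype.card V) with hm
  have hPm : P m := Nat.findGreatest_spec (hb 2 h2) h2
  have h2m : 2 ≤ m := Nat.le_findGreatest (hb 2 h2) h2
  have hmax : ∀ k, P k → k ≤ m := fun k hk => Nat.le_findGreatest (hb k hk) hk
  obtain ⟨a, b, l, hl, hba, hn, hlm⟩ := hPm
  have hpos : 0 < l.length := by omega
  have hmod : ∀ i, i % l.length < l.length := fun i => Nat.mod_lt _ hpos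
  refine ⟨fun i => l[i % l.length]'(hmod i), l.length, by omega, ?_, ?_, ?_, ?_⟩
  · intro i
    simp
  · intro i j hij hji h
    have h' := (hn.getElem_inj_iff (hi := hmod i) (hj := hmod j)).1 h
    have : i ≡ j [MOD l.length] := h'
    rw [Nat.modEq_iff_dvd' hij.le] at this
    have := Nat.le_of_dvd (by omega) this
    omega
  · intro i
    have hi := hmod i
    by_cases h : i % l.length + 1 < l.length
    · have e : (i + 1) % l.length = i % l.length + 1 := by
        rw [Nat.add_mod, Nat.mod_eq_of_lt (a := 1) (by omega), Nat.mod_eq_of_lt h]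
      simp only [e]
      exact List.isChain_iff_getElem.1 hl.chain _ h
    · have e1 : i % l.length = l.length - 1 := by omega
      have e : (i + 1) % l.length = 0 := by
        rw [Nat.add_mod, Nat.mod_eq_of_lt (a := 1) (by omega), e1, Nat.sub_add_cancel (by omega),
          Nat.mod_self]
      have h0 := hl.head
      have h1 := hl.last
      rw [List.head?_eq_getElem?, List.getElem?_eq_some_iff] at h0
      rw [List.getLast?_eq_getElem?, List.getElem?_eq_some_iff] at h1
      obtain ⟨_, h0⟩ := h0
      obtain ⟨_, h1⟩ := h1
      simp only [e, e1, h0, h1]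
      exact hba
  · intro a' b' l' h1 h2 h3
    rw [hlm]
    exact hmax _ ⟨a', b', l', h1, h2, h3, rfl⟩

/-! ### Exchange arguments on a longest cycle -/

namespace IsLongestCycle

variable {c : ℕ → V} {m : ℕ} (hc : G.IsLongestCycle c m)
include hc

theorem shift (k : ℕ) : G.IsLongestCycle (fun i => c (i + k)) m where
  two_le := hc.two_le
  periodic i := by rw [show i + m + k = i + k + m by ring, hc.periodic]
  inj i j h h' := hc.inj _ _ (by omega) (by omega)
  adj i := by
    have := hc.adj (i + k)
    rwa [show i + k + 1 = i + 1 + k by ring] at this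
  max := hc.max

theorem nodup_seg {a k : ℕ} (hk : k ≤ m) : (seg c a k).Nodup := by
  unfold seg
  refine List.Nodup.map_on ?_ List.nodup_range'
  intro x hx y hy hxy
  rw [List.mem_range'_1] at hx hy
  by_contra hne
  rcases Nat.lt_or_gt_of_ne hne with h | h
  · exact hc.inj x y h (by omega) hxy
  · exact hc.inj y x h (by omega) hxy.symm

theorem walk_seg {a b k : ℕ} (h : b + 1 = a + k) (hk : 0 < k) :
    G.IsListWalk (c a) (c b) (seg c a k) :=
  isListWalk_seg hc.adj h hk

/-- A rearrangement of parts of a longest cycle and of a list of vertices off the cycle that again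
forms a cycle is not longer. -/
theorem false_of_longer {a : ℕ} {Q l : List V} {x y : V} (hQ : Q.Nodup)
    (hQc : ∀ q ∈ Q, ∀ i, c i ≠ q) (hl : G.IsListWalk x y l) (hyx : G.Adj y x)
    (hsub : l.Subperm (seg c a m ++ Q)) (hlen : m < l.length) : False := by
  have hn : (seg c a m ++ Q).Nodup := by
    rw [List.nodup_append']
    refine ⟨hc.nodup_seg le_rfl, hQ, fun v hv hq => ?_⟩
    obtain ⟨i, -, -, hi⟩ := mem_seg.1 hv
    exact hQc v hq i hi
  obtain ⟨l', hl', hs⟩ := hsub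
  have := hc.max x y l hl hyx (hl'.nodup_iff.1 (hn.sublist hs))
  omega

/-- Otherwise a detour through `Q` could replace the edge from `c i` to `c (i + 1)`. -/
theorem not_insert {i : ℕ} {s t : V} {Q : List V} (hQ : G.IsListWalk s t Q) (hn : Q.Nodup)
    (hQc : ∀ q ∈ Q, ∀ j, c j ≠ q) (hs : G.Adj (c i) s) (ht : G.Adj t (c (i + 1))) : False := by
  have hm := hc.two_le
  have h := hc.walk_seg (a := i + 1) (b := i + m) (k := m) (by omega) (by omega)
  have h' := h.append hQ (by rw [hc.periodic]; exact hs)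
  refine hc.false_of_longer (a := i + 1) hn hQc h' ht (List.Perm.refl _).subperm ?_
  have := hQ.length_pos
  simp only [List.length_append, length_seg]
  omega

/-- Go forward from `c (i + 1)` to `c j`, cross to `c i` through `Q` reversed, and go backward to `c
(j + 1)`. Any way of closing this walk gives a longer cycle; the next two lemmas close it by an edge
and by a further vertex `z`. -/
theorem exists_crossing_walk {i j : ℕ} {s t : V} {Q : List V} (hQ : G.IsListWalk s t Q)
    (hij : i < j) (hji : j < i + m) (hs : G.Adj (c i) s) (ht : G.Adj t (c j)) :
    ∃ l, G.IsListWalk (c (i + 1)) (c (j + 1)) l ∧ l.Perm (seg c (i + 1) m ++ Q) := by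
  have h1 := hc.walk_seg (a := i + 1) (b := j) (k := j - i) (by omega) (by omega)
  have h2 := hc.walk_seg (a := j + 1) (b := i + m) (k := m - (j - i)) (by omega) (by omega)
  have e : seg c (i + 1) m = seg c (i + 1) (j - i) ++ seg c (j + 1) (m - (j - i)) := by
    have := seg_append c (i + 1) (j - i) (m - (j - i))
    rw [show i + 1 + (j - i) = j + 1 by omega, show j - i + (m - (j - i)) = m by omega] at this
    exact this.symm
  refine ⟨_, (h1.append hQ.reverse ht.symm).append h2.reverse
    (by rw [hc.periodic]; exact hs.symm), ?_⟩
  classical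
  rw [List.perm_iff_count]
  intro v
  simp only [e, List.count_append, List.count_reverse]
  omega

theorem not_adj_succ_succ {i j : ℕ} {s t : V} {Q : List V} (hQ : G.IsListWalk s t Q)
    (hn : Q.Nodup) (hQc : ∀ q ∈ Q, ∀ k, c k ≠ q) (hij : i < j) (hji : j < i + m)
    (hs : G.Adj (c i) s) (ht : G.Adj t (c j)) : ¬ G.Adj (c (i + 1)) (c (j + 1)) := by
  intro hadj
  obtain ⟨l, hl, hp⟩ := hc.exists_crossing_walk hQ hij hji hs ht
  refine hc.false_of_longer hn hQc hl hadj.symm hp.subperm ?_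
  have := hQ.length_pos
  rw [hp.length_eq]
  simp only [List.length_append, length_seg]
  omega

theorem not_adj_succ_of_adj_succ {i j : ℕ} {s t z : V} {Q : List V} (hQ : G.IsListWalk s t Q)
    (hn : Q.Nodup) (hQc : ∀ q ∈ Q, ∀ k, c k ≠ q) (hij : i < j) (hji : j < i + m)
    (hs : G.Adj (c i) s) (ht : G.Adj t (c j)) (hzQ : z ∉ Q) (hzc : ∀ k, c k ≠ z)
    (hi : G.Adj (c (i + 1)) z) : ¬ G.Adj (c (j + 1)) z := by
  intro hj
  obtain ⟨l, hl, hp⟩ := hc.exists_crossing_walk hQ hij hji hs ht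
  refine hc.false_of_longer (Q := Q ++ [z]) (a := i + 1) ?_ ?_ (hl.concat hj) hi.symm ?_ ?_
  · simpa [List.nodup_append] using ⟨hn, fun a ha h => hzQ (h ▸ ha)⟩
  · intro q hq k
    rcases List.mem_append.1 hq with hq | hq
    · exact hQc q hq k
    · rw [List.mem_singleton.1 hq]
      exact hzc k
  · rw [← List.append_assoc]
    exact (hp.append_right _).subperm
  · rw [List.length_append, hp.length_eq]
    simp only [List.length_append, length_seg, List.length_singleton]
    omega

/-- The rerouted cycle leaves out `c (j + 1)` but gains the vertices of `Q`, which is a net gain as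
soon as `Q` has two of them. -/
theorem not_adj_succ_add_two {i j : ℕ} {s t : V} {Q : List V} (hQ : G.IsListWalk s t Q)
    (hn : Q.Nodup) (hQ2 : 2 ≤ Q.length) (hQc : ∀ q ∈ Q, ∀ k, c k ≠ q) (hij : i < j)
    (hji : j + 2 ≤ i + m) (hs : G.Adj (c j) s) (ht : G.Adj t (c i)) :
    ¬ G.Adj (c (i + 1)) (c (j + 2)) := by
  intro hadj
  have h1 := hc.walk_seg (a := i + 1) (b := j) (k := j - i) (by omega) (by omega)
  have h2 := hc.walk_seg (a := j + 2) (b := i + m) (k := m - (j - i) - 1) (by omega) (by omega)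
  have e : seg c (i + 1) m =
      seg c (i + 1) (j - i) ++ seg c (j + 1) 1 ++ seg c (j + 2) (m - (j - i) - 1) := by
    have := seg_append c (i + 1) (j - i) 1
    rw [show i + 1 + (j - i) = j + 1 by omega] at this
    rw [this]
    have := seg_append c (i + 1) (j - i + 1) (m - (j - i) - 1)
    rw [show i + 1 + (j - i + 1) = j + 2 by omega,
      show j - i + 1 + (m - (j - i) - 1) = m by omega] at this
    exact this.symm
  have hl := (h1.append hQ hs).append h2.reverse (by rw [hc.periodic]; exact ht)
  refine hc.false_of_longer (a := i + 1) hn hQc hl hadj.symm ?_ ?_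
  · classical
    rw [List.subperm_ext_iff]
    intro v _
    simp only [e, List.count_append, List.count_reverse]
    omega
  · simp only [List.length_append, length_seg, List.length_reverse]
    omega

/-- If `c i` and `c j` are linked off the cycle, then no consecutive vertices between `c i` and
`c j` are joined, in this order, to the successors of `c j` and `c i`. -/
theorem not_adj_of_adj_before {i j k : ℕ} {s t : V} {Q : List V} (hQ : G.IsListWalk s t Q)
    (hn : Q.Nodup) (hQc : ∀ q ∈ Q, ∀ k, c k ≠ q) (hik : i < k) (hkj : k < j) (hji : j < i + m)
    (hs : G.Adj (c i) s) (ht : G.Adj t (c j)) (hk : G.Adj (c (j + 1)) (c k)) :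
    ¬ G.Adj (c (i + 1)) (c (k + 1)) := by
  intro hadj
  have h1 := hc.walk_seg (a := i + 1) (b := k) (k := k - i) (by omega) (by omega)
  have h2 := hc.walk_seg (a := k + 1) (b := j) (k := j - k) (by omega) (by omega)
  have h3 := hc.walk_seg (a := j + 1) (b := i + m) (k := m - (j - i)) (by omega) (by omega)
  have e : seg c (i + 1) m =
      seg c (i + 1) (k - i) ++ seg c (k + 1) (j - k) ++ seg c (j + 1) (m - (j - i)) := by
    have := seg_append c (i + 1) (k - i) (j - k)
    rw [show i + 1 + (k - i) = k + 1 by omega] at this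
    rw [this]
    have := seg_append c (i + 1) (k - i + (j - k)) (m - (j - i))
    rw [show i + 1 + (k - i + (j - k)) = j + 1 by omega,
      show k - i + (j - k) + (m - (j - i)) = m by omega] at this
    exact this.symm
  -- The order is `c (i + 1) … c k`, then `c (j + 1) … c i`, then `Q`, then `c j` backward to `c (k
  -- + 1)`.
  have hl := ((h1.append h3 hk.symm).append hQ (by rw [hc.periodic]; exact hs)).append
    h2.reverse ht
  refine hc.false_of_longer (a := i + 1) hn hQc hl hadj.symm ?_ ?_
  · classical
    rw [List.subperm_ext_iff]
    intro v _
    simp only [e, List.count_append, List.count_reverse]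
    omega
  · have := hQ.length_pos
    simp only [List.length_append, length_seg, List.length_reverse]
    omega

end IsLongestCycle

/-! ### Small separators and toughness -/

/-- In a graph of toughness greater than one, a set separating some vertices from the rest has at
least three elements. -/
theorem IsTough.three_le_card [Fintype V] {β : ℝ} (h : G.IsTough β) (hβ : 1 < β) {K : Set V}
    {S : Finset V} {k z : V} (hk : k ∈ K) (hkS : k ∉ S) (hz : z ∉ K) (hzS : z ∉ S)
    (hKS : ∀ a b, a ∈ K → b ∉ K → G.Adj a b → a ∈ S ∨ b ∈ S) : 3 ≤ S.card := by
  classical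
  set H := G.induce ((S : Set V)ᶜ) with hH
  -- No edge leaves `K` after deleting `S`, so `k` and `z` lie in different components.
  have key : ∀ x y : ((S : Set V)ᶜ : Set V), H.Reachable x y → (x : V) ∈ K → (y : V) ∈ K := by
    rintro x y ⟨p⟩
    induction p with
    | nil => exact id
    | cons hadj p ih =>
      intro hx
      refine ih (by_contra fun hy => ?_)
      rcases hKS _ _ hx hy hadj with h' | h'
      · exact (Subtype.property _ : _ ∈ ((S : Set V)ᶜ)) h'
      · exact (Subtype.property _ : _ ∈ ((S : Set V)ᶜ)) h'
  have hne : H.connectedComponentMk ⟨k, by simpa using hkS⟩ ≠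
      H.connectedComponentMk ⟨z, by simpa using hzS⟩ := by
    intro he
    exact hz (key _ _ (ConnectedComponent.exact he) hk)
  have h2 : 2 ≤ Nat.card H.ConnectedComponent := by
    have : Nontrivial H.ConnectedComponent := ⟨⟨_, _, hne⟩⟩
    exact Finite.one_lt_card
  have h3 := h S _ h2 rfl
  have h4 : (2 : ℝ) < S.card := by
    have : (2 : ℝ) ≤ (Nat.card H.ConnectedComponent : ℝ) := by exact_mod_cast h2
    nlinarith
  exact_mod_cast h4

theorem IsTough.exists_adj [Fintype V] [Nontrivial V] {β : ℝ} (h : G.IsTough β) (hβ : 1 < β) :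
    ∃ v w, G.Adj v w := by
  obtain ⟨v, w, hvw⟩ := exists_pair_ne V
  by_contra! hno
  have := h.three_le_card hβ (K := {v}) (S := ∅) (k := v) (z := w) (by simp) (by simp)
    (by simpa using hvw.symm) (by simp) (fun a b _ _ hab => absurd hab (hno a b))
  simp at this

/-- The set of vertices that can be reached from `v` in `G` without entering `D`. -/
def reachAvoiding (G : SimpleGraph V) (D : Set V) (v : V) : Set V :=
  {w | ∃ p : G.Walk v w, ∀ x ∈ p.support, x ∉ D}

theorem mem_reachAvoiding_self {D : Set V} {v : V} (hv : v ∉ D) : v ∈ G.reachAvoiding D v :=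
  ⟨Walk.nil, by simpa using hv⟩

theorem notMem_of_mem_reachAvoiding {D : Set V} {v w : V} (hw : w ∈ G.reachAvoiding D v) :
    w ∉ D := by
  obtain ⟨p, hp⟩ := hw
  exact hp w p.end_mem_support

theorem mem_reachAvoiding_of_adj {D : Set V} {v w x : V} (hw : w ∈ G.reachAvoiding D v)
    (hwx : G.Adj w x) (hx : x ∉ D) : x ∈ G.reachAvoiding D v := by
  obtain ⟨p, hp⟩ := hw
  refine ⟨p.concat hwx, fun y hy => ?_⟩
  rw [Walk.support_concat, List.mem_append, List.mem_singleton] at hy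
  rcases hy with hy | rfl
  · exact hp y hy
  · exact hx

theorem exists_isListWalk_reachAvoiding {D : Set V} {v a b : V} (ha : a ∈ G.reachAvoiding D v)
    (hb : b ∈ G.reachAvoiding D v) :
    ∃ Q, G.IsListWalk a b Q ∧ Q.Nodup ∧ ∀ q ∈ Q, q ∈ G.reachAvoiding D v := by
  classical
  obtain ⟨p, hp⟩ := ha
  obtain ⟨q, hq⟩ := hb
  refine ⟨_, (p.reverse.append q).bypass.isListWalk_support,
    (p.reverse.append q).bypass_isPath.support_nodup, fun x hx => ?_⟩
  have hx := Walk.support_bypass_subset_support _ hx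
  rw [Walk.mem_support_append_iff, Walk.support_reverse, List.mem_reverse] at hx
  rcases hx with hx | hx
  · exact ⟨p.takeUntil x hx, fun y hy => hp y (p.support_takeUntil_subset_support hx hy)⟩
  · exact ⟨q.takeUntil x hx, fun y hy => hq y (q.support_takeUntil_subset_support hx hy)⟩

/-! ### Longest cycles are dominating -/

theorem le_degree_add_degree_add_degree [Fintype V] [DecidableEq V] [DecidableRel G.Adj] {k : ℕ}
    (h : (k : ℕ∞) ≤ G.deltaThree) {x y z : V} (hxy : x ≠ y) (hxz : x ≠ z) (hyz : y ≠ z)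
    (hxy' : ¬ G.Adj x y) (hxz' : ¬ G.Adj x z) (hyz' : ¬ G.Adj y z) :
    k ≤ G.degree x + G.degree y + G.degree z := by
  have hs : G.IsNIndepSet 3 {x, y, z} := by
    refine ⟨?_, Finset.card_eq_three.2 ⟨x, y, z, hxy, hxz, hyz, rfl⟩⟩
    rw [isIndepSet_iff]
    intro a ha b hb _
    simp only [Finset.coe_insert, Finset.coe_singleton, Set.mem_insert_iff,
      Set.mem_singleton_iff] at ha hb
    rcases ha with rfl | rfl | rfl <;> rcases hb with rfl | rfl | rfl <;>
      first
        | assumption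
        | exact G.irrefl
        | (rw [adj_comm]; assumption)
  have h1 : G.deltaThree ≤ _ := iInf₂_le ({x, y, z} : Finset V) hs
  have h2 := h.trans h1
  rw [Finset.sum_insert (by simp [hxy, hxz]), Finset.sum_insert (by simp [hyz]),
    Finset.sum_singleton] at h2
  have := Nat.cast_le.1 h2
  omega

namespace IsLongestCycle

variable {c : ℕ → V} {m : ℕ}

theorem exists_lt (hc : G.IsLongestCycle c m) (i : ℕ) : ∃ j < m, c j = c i := by
  have hm := hc.two_le
  induction i using Nat.strong_induction_on with
  | _ i ih =>
    by_cases h : i < m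
    · exact ⟨i, h, rfl⟩
    · obtain ⟨j, hj, hji⟩ := ih (i - m) (by omega)
      refine ⟨j, hj, hji.trans ?_⟩
      have := hc.periodic (i - m)
      rw [Nat.sub_add_cancel (by omega)] at this
      exact this.symm

/-- The vertices of `D` with a neighbour in the component of `u'` separate it from the rest of the
cycle, so there are at least three; all but possibly `u` lie on the cycle. -/
theorem adj_range_of_tough [Fintype V] (hc : G.IsLongestCycle c m) {β : ℝ} (h : G.IsTough β)
    (hβ : 1 < β) {D : Set V} {u u' : V} (hu' : u' ∉ D)
    (hcD : ∀ i, c i ∈ D) (hD : ∀ x ∈ D, (∃ i, c i = x) ∨ x = u) :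
    ∃ i p, 0 < p ∧ p < m ∧ (∃ k ∈ G.reachAvoiding D u', G.Adj (c i) k) ∧
      ∃ k ∈ G.reachAvoiding D u', G.Adj (c (i + p)) k := by
  classical
  set K := G.reachAvoiding D u' with hK
  have hcK : ∀ i, c i ∉ K := fun i hi => notMem_of_mem_reachAvoiding hi (hcD i)
  let S : Finset V := Finset.univ.filter fun x => x ∈ D ∧ ∃ k ∈ K, G.Adj x k
  have hmemS : ∀ x, x ∈ S ↔ x ∈ D ∧ ∃ k ∈ K, G.Adj x k := fun x => by simp [S]
  -- The separator must leave a cycle vertex: two consecutive attachments would allow an insertion.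
  obtain ⟨z, hz⟩ : ∃ i, c i ∉ S := by
    by_contra! hno
    obtain ⟨-, k, hk, hk'⟩ := (hmemS _).1 (hno 0)
    obtain ⟨-, l, hl, hl'⟩ := (hmemS _).1 (hno 1)
    obtain ⟨Q, hQ, hn, hQK⟩ := exists_isListWalk_reachAvoiding hk hl
    exact hc.not_insert hQ hn (fun q hq j h => hcK j (h ▸ hQK q hq)) hk' hl'.symm
  have h3 : 3 ≤ S.card := by
    refine h.three_le_card hβ (K := K) (mem_reachAvoiding_self hu')
      (fun h => hu' ((hmemS _).1 h).1) (hcK z) hz fun a b ha hb hab => Or.inr ?_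
    refine (hmemS _).2 ⟨?_, a, ha, hab.symm⟩
    by_contra hbD
    exact hb (mem_reachAvoiding_of_adj ha hab hbD)
  have h2 : 1 < (S.erase u).card := by
    have := Finset.pred_card_le_card_erase (s := S) (a := u)
    omega
  obtain ⟨a, ha, b, hb, hab⟩ := Finset.one_lt_card.1 h2
  have aux : ∀ x ∈ S.erase u, ∃ i < m, c i = x ∧ ∃ k ∈ K, G.Adj x k := by
    intro x hx
    obtain ⟨hxu, hxS⟩ := Finset.mem_erase.1 hx
    obtain ⟨hxD, hxk⟩ := (hmemS x).1 hxS
    obtain ⟨i, rfl⟩ := (hD x hxD).resolve_right hxu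
    obtain ⟨j, hj, hji⟩ := hc.exists_lt i
    exact ⟨j, hj, hji, hxk⟩
  obtain ⟨i, hi, rfl, hik⟩ := aux a ha
  obtain ⟨j, hj, rfl, hjk⟩ := aux b hb
  have hij : i ≠ j := fun h => hab (h ▸ rfl)
  rcases Nat.lt_or_gt_of_ne hij with h | h
  · exact ⟨i, j - i, by omega, by omega, hik, by rwa [Nat.add_sub_cancel' h.le]⟩
  · exact ⟨j, i - j, by omega, by omega, hjk, by rwa [Nat.add_sub_cancel' h.le]⟩

end IsLongestCycle

/-- `A`, `B` and `U` stand for the positions of the neighbours of `c 1`, `c (p + 1)` and `u`. Moving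
positions by at most one, differently up to `p` and beyond it, makes the three sets disjoint within
`1, …, m`. -/
theorem card_add_card_add_card_le_of_shifts {m p : ℕ} {A B U : Finset ℕ}
    (hA : ∀ i ∈ A, 2 ≤ i ∧ i ≤ m) (hB : ∀ i ∈ B, 1 ≤ i ∧ i ≤ m ∧ i ≠ p + 1)
    (hU : ∀ i ∈ U, i < m) (h1 : ∀ i, i ∈ B → i + 1 ∈ A → p < i + 1)
    (h2 : ∀ i, i ∈ A → i + 1 ∈ B → i ≤ p) (h3 : ∀ j, j ∈ U → j + 2 ∈ A → 0 < j → p < j + 2)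
    (h4 : ∀ j, j ∈ U → j + 1 ∈ A → j < p) (h5 : ∀ j, j ∈ U → j + 1 ∈ B → p ≤ j)
    (h6 : ∀ j, j ∈ U → j + 2 ∈ B → j ≤ p) : A.card + B.card + U.card ≤ m + 2 := by
  classical
  -- Positions `0` and `p` may violate disjointness; discarding them costs the `2` in the bound.
  set U' := (U.erase 0).erase p with hU'
  have hUc : U.card ≤ U'.card + 2 := by
    have e1 := Finset.pred_card_le_card_erase (s := U) (a := 0)
    have e2 := Finset.pred_card_le_card_erase (s := U.erase 0) (a := p)
    rw [← hU'] at e2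
    omega
  have hU'm : ∀ j ∈ U', j ∈ U ∧ j ≠ 0 ∧ j ≠ p := fun j hj => by
    simp only [hU', Finset.mem_erase] at hj
    tauto
  set A' := A.image fun i => if i ≤ p then i - 1 else i with hA'
  set B' := B.image fun i => if i ≤ p then i else i - 1 with hB'
  set U'' := U'.image fun i => i + 1 with hU''
  have cA : A'.card = A.card := by
    refine Finset.card_image_of_injOn fun i hi j hj hij => ?_
    have := hA i hi
    have := hA j hj
    split_ifs at hij <;> omega
  have cB : B'.card = B.card := by
    refine Finset.card_image_of_injOn fun i hi j hj hij => ?_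
    have := hB i hi
    have := hB j hj
    split_ifs at hij <;> omega
  have cU : U''.card = U'.card := Finset.card_image_of_injective _ (add_left_injective 1)
  have dAB : Disjoint A' B' := by
    rw [Finset.disjoint_left]
    intro x hx hx'
    obtain ⟨i, hi, rfl⟩ := Finset.mem_image.1 hx
    obtain ⟨j, hj, hji⟩ := Finset.mem_image.1 hx'
    have a1 := hA i hi
    have a2 := hB j hj
    split_ifs at hji
    · obtain rfl : i = j + 1 := by omega
      have := h1 j hj hi
      omega
    · omega
    · omega
    · obtain rfl : j = i + 1 := by omega
      have := h2 i hi hj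
      omega
  have dAU : Disjoint A' U'' := by
    rw [Finset.disjoint_left]
    intro x hx hx'
    obtain ⟨i, hi, rfl⟩ := Finset.mem_image.1 hx
    obtain ⟨j, hj, hji⟩ := Finset.mem_image.1 hx'
    have a1 := hA i hi
    obtain ⟨b1, b2, b3⟩ := hU'm j hj
    split_ifs at hji
    · obtain rfl : i = j + 2 := by omega
      have := h3 j b1 hi (by omega)
      omega
    · obtain rfl : i = j + 1 := by omega
      have := h4 j b1 hi
      omega
  have dBU : Disjoint B' U'' := by
    rw [Finset.disjoint_left]
    intro x hx hx'
    obtain ⟨i, hi, rfl⟩ := Finset.mem_image.1 hx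
    obtain ⟨j, hj, hji⟩ := Finset.mem_image.1 hx'
    have a1 := hB i hi
    obtain ⟨b1, b2, b3⟩ := hU'm j hj
    split_ifs at hji
    · obtain rfl : i = j + 1 := by omega
      have := h5 j b1 hi
      omega
    · obtain rfl : i = j + 2 := by omega
      have := h6 j b1 hi
      omega
  have hsub : A' ∪ B' ∪ U'' ⊆ Finset.Icc 1 m := by
    intro x hx
    rw [Finset.mem_Icc]
    rcases Finset.mem_union.1 hx with hx | hx
    · rcases Finset.mem_union.1 hx with hx | hx
      · obtain ⟨i, hi, rfl⟩ := Finset.mem_image.1 hx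
        have := hA i hi
        split_ifs <;> omega
      · obtain ⟨i, hi, rfl⟩ := Finset.mem_image.1 hx
        have := hB i hi
        split_ifs <;> omega
    · obtain ⟨i, hi, rfl⟩ := Finset.mem_image.1 hx
      have := hU i (hU'm i hi).1
      omega
  have := Finset.card_le_card hsub
  rw [Finset.card_union_of_disjoint (Finset.disjoint_union_left.2 ⟨dAU, dBU⟩),
    Finset.card_union_of_disjoint dAB, Nat.card_Icc] at this
  omega

/-- The index set is left free because the count below uses `1, …, m` for the two successors and `0,
…, m - 1` for `u`. -/
theorem degree_le_of_indices [Fintype V] [DecidableEq V] [DecidableRel G.Adj] {c : ℕ → V}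
    {m : ℕ} {I : Finset ℕ} (hI : ∀ i < m, ∃ j ∈ I, c j = c i) (x : V) :
    G.degree x ≤ (I.filter fun i => G.Adj x (c i)).card +
      (((Finset.range m).image c)ᶜ.filter fun y => G.Adj x y).card := by
  have hsub : G.neighborFinset x ⊆ ((I.filter fun i => G.Adj x (c i)).image c) ∪
      (((Finset.range m).image c)ᶜ.filter fun y => G.Adj x y) := by
    intro y hy
    rw [mem_neighborFinset] at hy
    rw [Finset.mem_union]
    by_cases h : y ∈ ((Finset.range m).image c)ᶜ
    · exact Or.inr (Finset.mem_filter.2 ⟨h, hy⟩)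
    · left
      rw [Finset.notMem_compl, Finset.mem_image] at h
      obtain ⟨i, hi, rfl⟩ := h
      obtain ⟨j, hj, hji⟩ := hI i (Finset.mem_range.1 hi)
      exact Finset.mem_image.2 ⟨j, Finset.mem_filter.2 ⟨hj, hji ▸ hy⟩, hji⟩
  rw [← card_neighborFinset_eq_degree]
  exact (Finset.card_le_card hsub).trans
    ((Finset.card_union_le _ _).trans (Nat.add_le_add_right Finset.card_image_le _))

namespace IsLongestCycle

variable {c : ℕ → V} {m : ℕ}

theorem card_compl_image [Fintype V] [DecidableEq V] (hc : G.IsLongestCycle c m) :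
    ((Finset.range m).image c)ᶜ.card + m = Fintype.card V := by
  have : ((Finset.range m).image c).card = m := by
    rw [Finset.card_image_of_injOn, Finset.card_range]
    intro i hi j hj hij
    simp only [Finset.coe_range, Set.mem_Iio] at hi hj
    by_contra hne
    rcases Nat.lt_or_gt_of_ne hne with h | h
    · exact hc.inj i j h (by omega) hij
    · exact hc.inj j i h (by omega) hij.symm
  have h2 := Finset.card_compl_add_card ((Finset.range m).image c)
  omega

theorem mem_compl_image [Fintype V] [DecidableEq V] (hc : G.IsLongestCycle c m) {v : V} :
    v ∈ ((Finset.range m).image c)ᶜ ↔ ∀ i, c i ≠ v := by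
  simp only [Finset.mem_compl, Finset.mem_image, Finset.mem_range, not_exists, not_and]
  refine ⟨fun h i hi => ?_, fun h i _ => h i⟩
  obtain ⟨j, hj, hji⟩ := hc.exists_lt i
  exact h j hj (hji.trans hi)

/-- The vertices `u`, `c 1` and `c (p + 1)` are independent. They have at most `m + 2` adjacencies
to the cycle and at most `n - m - 1` off it, one less than `δ₃` requires. -/
theorem false_of_attached [Fintype V] [DecidableEq V] [DecidableRel G.Adj]
    (hc : G.IsLongestCycle c m) (hdeg : ((Fintype.card V + 2 : ℕ) : ℕ∞) ≤ G.deltaThree)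
    {D : Set V} {u u' : V} {p : ℕ} (hcD : ∀ i, c i ∈ D) (huD : u ∈ D) (hu : ∀ i, c i ≠ u)
    (hD : ∀ x ∈ D, (∃ i, c i = x) ∨ x = u)
    (hu' : u' ∉ D) (huu' : G.Adj u u') (hp : 0 < p) (hpm : p < m)
    (h0 : ∃ k ∈ G.reachAvoiding D u', G.Adj (c 0) k)
    (h0' : ∃ k ∈ G.reachAvoiding D u', G.Adj (c p) k) : False := by
  have hK := @mem_reachAvoiding_self V G D u' hu'
  set K := G.reachAvoiding D u' with hKdef
  obtain ⟨k, hk, hk0⟩ := h0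
  obtain ⟨l, hl, hlp⟩ := h0'
  have hKD : ∀ x ∈ K, x ∉ D := fun x hx => notMem_of_mem_reachAvoiding hx
  have hKc : ∀ x ∈ K, ∀ i, c i ≠ x := fun x hx i h => hKD x hx (h ▸ hcD i)
  have huK : u ∉ K := fun h => hKD u h huD
  -- walks off the cycle
  have hlink : ∀ a ∈ K, ∀ b ∈ K, ∃ Q, G.IsListWalk a b Q ∧ Q.Nodup ∧ (∀ q ∈ Q, q ∈ K) ∧
      ∀ q ∈ Q, ∀ i, c i ≠ q := by
    intro a ha b hb
    obtain ⟨Q, h1, h2, h3⟩ := exists_isListWalk_reachAvoiding ha hb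
    exact ⟨Q, h1, h2, h3, fun q hq => hKc q (h3 q hq)⟩
  have hulink : ∀ b ∈ K, ∃ Q, G.IsListWalk u b Q ∧ Q.Nodup ∧ 2 ≤ Q.length ∧
      (∀ q ∈ Q, q ∈ K ∨ q = u) ∧ ∀ q ∈ Q, ∀ i, c i ≠ q := by
    intro b hb
    obtain ⟨Q, h1, h2, h3, h4⟩ := hlink u' hK b hb
    have := h1.length_pos
    refine ⟨u :: Q, h1.cons huu', List.nodup_cons.2 ⟨fun h => huK (h3 u h), h2⟩, ?_, ?_, ?_⟩
    · rw [List.length_cons]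
      omega
    · intro q hq
      rcases List.mem_cons.1 hq with rfl | hq
      · exact Or.inr rfl
      · exact Or.inl (h3 q hq)
    · intro q hq
      rcases List.mem_cons.1 hq with rfl | hq
      · exact hu
      · exact h4 q hq
  have succK : ∀ i, ∀ a ∈ K, G.Adj (c i) a → ∀ b ∈ K, ¬ G.Adj (c (i + 1)) b := by
    intro i a ha hia b hb hib
    obtain ⟨Q, h1, h2, -, h4⟩ := hlink a ha b hb
    exact hc.not_insert h1 h2 h4 hia hib.symm
  have succu : ∀ i, ∀ a ∈ K, G.Adj (c i) a → ¬ G.Adj u (c (i + 1)) := by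
    intro i a ha hia hib
    obtain ⟨Q, h1, h2, -, -, h4⟩ := hulink a ha
    exact hc.not_insert h1.reverse (List.nodup_reverse.2 h2) (by simpa using h4) hia hib
  obtain ⟨Q, hQ, hQn, hQK, hQc⟩ := hlink k hk l hl
  obtain ⟨Qk, hQk, hQkn, hQk2, -, hQkc⟩ := hulink k hk
  obtain ⟨Ql, hQl, hQln, hQl2, -, hQlc⟩ := hulink l hl
  have hne : c 1 ≠ c (p + 1) := hc.inj _ _ (by omega) (by omega)
  have hnadj : ¬ G.Adj (c 1) (c (p + 1)) :=
    hc.not_adj_succ_succ hQ hQn hQc hp (by omega) hk0 hlp.symm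
  have hu1 := succu 0 k hk hk0
  have hup := succu p l hl hlp
  have hsum := le_degree_add_degree_add_degree hdeg (hu 1).symm (hu (p + 1)).symm hne hu1 hup hnadj
  have hcm : c m = c 0 := by simpa using hc.periodic 0
  have hcm1 : c (m + 1) = c 1 := by rw [add_comm, hc.periodic]
  have hIcc : ∀ i < m, ∃ j ∈ Finset.Icc 1 m, c j = c i := by
    intro i hi
    rcases Nat.eq_zero_or_pos i with rfl | h
    · exact ⟨m, Finset.mem_Icc.2 ⟨by omega, le_rfl⟩, hcm⟩
    · exact ⟨i, Finset.mem_Icc.2 ⟨h, hi.le⟩, rfl⟩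
  have d1 := degree_le_of_indices (G := G) hIcc (c 1)
  have d2 := degree_le_of_indices (G := G) hIcc (c (p + 1))
  have d3 := degree_le_of_indices (G := G) (c := c) (I := Finset.range m)
    (fun i hi => ⟨i, Finset.mem_range.2 hi, rfl⟩) u
  -- neighbours on the cycle
  have con : ((Finset.Icc 1 m).filter fun i => G.Adj (c 1) (c i)).card +
      ((Finset.Icc 1 m).filter fun i => G.Adj (c (p + 1)) (c i)).card +
      ((Finset.range m).filter fun i => G.Adj u (c i)).card ≤ m + 2 := by
    apply card_add_card_add_card_le_of_shifts (p := p) <;>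
      simp only [Finset.mem_filter, Finset.mem_Icc, Finset.mem_range]
    · rintro i ⟨⟨h1, h2⟩, h3⟩
      refine ⟨?_, h2⟩
      by_contra! h
      obtain rfl : i = 1 := by omega
      exact G.irrefl h3
    · rintro i ⟨⟨h1, h2⟩, h3⟩
      refine ⟨h1, h2, ?_⟩
      rintro rfl
      exact G.irrefl h3
    · exact fun i hi => hi.1
    · rintro i ⟨⟨h1, h2⟩, h3⟩ ⟨-, h4⟩
      by_contra! h
      exact hc.not_adj_of_adj_before hQ hQn hQc (i := 0) (j := p) (k := i) (by omega) (by omega)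
        (by omega) hk0 hlp.symm h3 h4
    · rintro i ⟨⟨h1, h2⟩, h3⟩ ⟨⟨-, h5⟩, h4⟩
      by_contra! h
      -- The same exchange on the other arc, from `c p` to `c m = c 0`.
      exact hc.not_adj_of_adj_before hQ.reverse (List.nodup_reverse.2 hQn) (by simpa using hQc)
        (i := p) (j := m) (k := i) (by omega) (by omega) (by omega) hlp (hcm ▸ hk0.symm)
        (hcm1 ▸ h3) h4
    · rintro j ⟨h1, h2⟩ ⟨⟨-, h4⟩, h5⟩ h6
      by_contra! h
      exact hc.not_adj_succ_add_two hQk hQkn hQk2 hQkc (i := 0) (j := j) h6 (by omega) h2.symm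
        hk0.symm h5
    · rintro j ⟨h1, h2⟩ ⟨⟨-, h4⟩, h5⟩
      by_contra! h
      exact hc.not_adj_succ_succ hQk.reverse (List.nodup_reverse.2 hQkn) (by simpa using hQkc)
        (i := 0) (j := j) (by omega) (by omega) hk0 h2 h5
    · rintro j ⟨h1, h2⟩ ⟨⟨-, h4⟩, h5⟩
      by_contra! h
      exact hc.not_adj_succ_succ hQl hQln hQlc (i := j) (j := p) (by omega) (by omega) h2.symm
        hlp.symm h5.symm
    · rintro j ⟨h1, h2⟩ ⟨⟨-, h4⟩, h5⟩
      by_contra! h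
      exact hc.not_adj_succ_add_two hQl hQln hQl2 hQlc (i := p) (j := j) h (by omega) h2.symm
        hlp.symm h5
  -- neighbours off the cycle
  set R := ((Finset.range m).image c)ᶜ with hR
  have hRc : ∀ z ∈ R, ∀ i, c i ≠ z := fun z hz => hc.mem_compl_image.1 hz
  have coff : (R.filter fun y => G.Adj (c 1) y).card +
      (R.filter fun y => G.Adj (c (p + 1)) y).card + (R.filter fun y => G.Adj u y).card + 1 ≤
      R.card := by
    -- A common neighbour `z` outside `K` would give a detour from `c i` through `K`, `u` and `z` to
    -- `c (i + 1)`.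
    have huz : ∀ i, ∀ a ∈ K, G.Adj (c i) a → ∀ z ∈ R, G.Adj (c (i + 1)) z → ¬ G.Adj u z := by
      intro i a ha hia z hz h1 h2
      by_cases hzK : z ∈ K
      · exact succK i a ha hia z hzK h1
      · obtain ⟨Q', b1, b2, -, b3, b4⟩ := hulink a ha
        refine hc.not_insert (b1.reverse.concat h2) ?_ ?_ hia h1.symm
        · rw [List.nodup_append']
          refine ⟨List.nodup_reverse.2 b2, List.nodup_singleton _, fun x hx hx' => ?_⟩
          obtain rfl := List.mem_singleton.1 hx'
          rcases b3 x (List.mem_reverse.1 hx) with h | rfl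
          · exact hzK h
          · exact G.irrefl h2
        · intro q hq
          rcases List.mem_append.1 hq with hq | hq
          · exact b4 q (List.mem_reverse.1 hq)
          · rw [List.mem_singleton.1 hq]
            exact hRc z hz
    have e1 : Disjoint (R.filter fun y => G.Adj (c 1) y)
        (R.filter fun y => G.Adj (c (p + 1)) y) := by
      rw [Finset.disjoint_filter]
      intro z hz h1 h2
      by_cases hzK : z ∈ K
      · exact succK 0 k hk hk0 z hzK h1
      · exact hc.not_adj_succ_of_adj_succ hQ hQn hQc hp (by omega) hk0 hlp.symm
          (fun h => hzK (hQK z h)) (hRc z hz) h1 h2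
    have e2 : Disjoint (R.filter fun y => G.Adj (c 1) y) (R.filter fun y => G.Adj u y) := by
      rw [Finset.disjoint_filter]
      exact fun z hz h1 h2 => huz 0 k hk hk0 z hz h1 h2
    have e3 : Disjoint (R.filter fun y => G.Adj (c (p + 1)) y)
        (R.filter fun y => G.Adj u y) := by
      rw [Finset.disjoint_filter]
      exact fun z hz h1 h2 => huz p l hl hlp z hz h1 h2
    rw [← Finset.card_union_of_disjoint e1,
      ← Finset.card_union_of_disjoint (Finset.disjoint_union_left.2 ⟨e2, e3⟩)]
    -- The inclusion is strict because `u` lies off the cycle and is adjacent to none of the three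
    -- vertices.
    refine Finset.card_lt_card ⟨?_, fun h => ?_⟩
    · intro z hz
      simp only [Finset.mem_union, Finset.mem_filter] at hz
      tauto
    · have := h (hc.mem_compl_image.2 hu)
      simp only [Finset.mem_union, Finset.mem_filter, G.irrefl, G.adj_comm _ u] at this
      tauto
  have := hc.card_compl_image
  rw [← hR] at this
  omega

/-- If a graph of toughness greater than one satisfies `n + 2 ≤ δ₃`, then there is no edge off a
longest cycle. -/
theorem not_adj_of_off [Fintype V] [DecidableEq V] [DecidableRel G.Adj]
    (hc : G.IsLongestCycle c m) {β : ℝ} (h : G.IsTough β) (hβ : 1 < β)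
    (hdeg : ((Fintype.card V + 2 : ℕ) : ℕ∞) ≤ G.deltaThree) {u u' : V} (hu : ∀ i, c i ≠ u)
    (hu' : ∀ i, c i ≠ u') : ¬ G.Adj u u' := by
  intro huu'
  let D : Set V := Set.range c ∪ {u}
  have hcD : ∀ i, c i ∈ D := fun i => Or.inl ⟨i, rfl⟩
  have hD : ∀ x ∈ D, (∃ i, c i = x) ∨ x = u := fun x hx => hx
  have hu'D : u' ∉ D := by
    rintro (⟨i, hi⟩ | rfl)
    · exact hu' i hi
    · exact G.irrefl huu'
  obtain ⟨i, p, hp, hpm, h0, h1⟩ := hc.adj_range_of_tough h hβ hu'D hcD hD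
  refine (hc.shift i).false_of_attached hdeg (D := D) (u := u) (u' := u') (p := p)
    (fun j => hcD _) (Or.inr rfl) (fun j => hu _) ?_ hu'D huu' hp hpm
    (by simpa using h0) (by simpa [add_comm] using h1)
  rintro x hx
  rcases hD x hx with ⟨j, rfl⟩ | rfl
  · left
    have hm := hc.two_le
    -- a multiple of the period exceeds the shift
    have hper : ∀ t, c (j + t * m) = c j := by
      intro t
      induction t with
      | zero => simp
      | succ t ih => rw [show j + (t + 1) * m = j + t * m + m by ring, hc.periodic, ih]
    refine ⟨j + i * m - i, ?_⟩
    have : i ≤ i * m := Nat.le_mul_of_pos_right i (by omega)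
    rw [Nat.sub_add_cancel (by omega), hper]
  · exact Or.inr rfl

end IsLongestCycle

/-! ### Hanging the remaining vertices at a cycle -/

/-- Hall's condition is immediate: a single set `t y` is already as large as all of `T`. -/
theorem exists_injOn_mem_of_card_le [DecidableEq V] {T : Finset V} {t : V → Finset V}
    (h : ∀ y ∈ T, T.card ≤ (t y).card) :
    ∃ f : V → V, Set.InjOn f T ∧ ∀ y ∈ T, f y ∈ t y := by
  obtain ⟨f, hf, hft⟩ := (Finset.all_card_le_biUnion_card_iff_exists_injective
    fun y : {y // y ∈ T} => t y).1 (by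
      intro s
      rcases s.eq_empty_or_nonempty with rfl | ⟨y, hy⟩
      · simp
      · calc s.card ≤ T.card := by simpa using s.card_le_univ
          _ ≤ (t y).card := h y y.2
          _ ≤ _ := Finset.card_le_card
            (Finset.subset_biUnion_of_mem (fun y : {y // y ∈ T} => t y) hy))
  refine ⟨fun y => if hy : y ∈ T then f ⟨y, hy⟩ else y, fun y hy z hz hyz => ?_, fun y hy => ?_⟩
  · have hy' : y ∈ T := hy
    have hz' : z ∈ T := hz
    simp only [hy', hz', dif_pos] at hyz
    simpa using hf hyz
  · simpa [hy] using hft ⟨y, hy⟩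

/-- A variant of `isPrismHamiltonian_of_hung_paths` in which the vertices of `T` are hung one by
one at distinct vertices of the closed walk. -/
theorem isPrismHamiltonian_of_matching [Fintype V] [DecidableEq V] {a b : V} {L : List V}
    (hL : G.IsListWalk a b L) (hba : G.Adj b a) (hn : L.Nodup) (heven : Even L.length)
    {F : V → List V} (hchain : ∀ v ∈ L, (v :: F v).IsChain G.Adj)
    (hnF : ∀ v ∈ L, (F v).Nodup) (hFL : ∀ v ∈ L, ∀ z ∈ F v, z ∉ L)
    (hFF : ∀ v ∈ L, ∀ w ∈ L, ∀ z ∈ F v, z ∈ F w → v = w)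
    {T : Finset V} {f : V → V} (hf : Set.InjOn f T) (hfT : ∀ y ∈ T, F (f y) = [])
    (hadj : ∀ y ∈ T, G.Adj (f y) y) (hTL : ∀ y ∈ T, y ∉ L)
    (hTF : ∀ y ∈ T, ∀ v ∈ L, y ∉ F v)
    (hcov : ∀ z, z ∈ L ∨ (∃ v ∈ L, z ∈ F v) ∨ z ∈ T ∧ f z ∈ L) : G.IsPrismHamiltonian := by
  have hT : ∀ v, (T.filter fun y => f y = v).toList = [] ∨
      ∃ y ∈ T, f y = v ∧ (T.filter fun y => f y = v).toList = [y] := by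
    intro v
    rcases (T.filter fun y => f y = v).eq_empty_or_nonempty with h | ⟨y, hy⟩
    · left
      rw [h, Finset.toList_empty]
    · right
      have hy' := Finset.mem_filter.1 hy
      refine ⟨y, hy'.1, hy'.2, ?_⟩
      rw [Finset.toList_eq_singleton_iff, Finset.eq_singleton_iff_unique_mem]
      refine ⟨hy, fun z hz => ?_⟩
      have hz' := Finset.mem_filter.1 hz
      exact hf hz'.1 hy'.1 (hz'.2.trans hy'.2.symm)
  have hmem : ∀ v z, z ∈ F v ++ (T.filter fun y => f y = v).toList ↔
      z ∈ F v ∨ z ∈ T ∧ f z = v := fun v z => by simp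
  refine isPrismHamiltonian_of_hung_paths hL hba hn heven
    (F := fun v => F v ++ (T.filter fun y => f y = v).toList) ?_ ?_ ?_ ?_ ?_
  · intro v hv
    rcases hT v with h | ⟨y, hy, rfl, h⟩
    · simpa [h] using hchain v hv
    · simpa [h, hfT y hy] using hadj y hy
  · intro v hv
    rcases hT v with h | ⟨y, hy, rfl, h⟩
    · simpa [h] using hnF v hv
    · simp [h, hfT y hy]
  · intro v hv z hz
    rcases (hmem v z).1 hz with h | h
    · exact hFL v hv z h
    · exact hTL z h.1
  · intro v hv w hw z hz hz'
    rcases (hmem v z).1 hz with h | h <;> rcases (hmem w z).1 hz' with h' | h'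
    · exact hFF v hv w hw z h h'
    · exact absurd h (hTF z h'.1 v hv)
    · exact absurd h' (hTF z h.1 w hw)
    · exact h.2.symm.trans h'.2
  · intro z
    rcases hcov z with h | ⟨v, hv, h⟩ | ⟨h, h'⟩
    · exact Or.inl h
    · exact Or.inr ⟨v, hv, (hmem v z).2 (Or.inl h)⟩
    · exact Or.inr ⟨f z, h', (hmem _ z).2 (Or.inr ⟨h, rfl⟩)⟩

theorem card_filter_Ico_le_of_not_consecutive {P : ℕ → Prop} [DecidablePred P]
    (hP : ∀ i, P i → ¬ P (i + 1)) (a k : ℕ) :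
    ((Finset.Ico a (a + k)).filter P).card ≤ (k + 1) / 2 := by
  induction k using Nat.strong_induction_on generalizing a with
  | _ k ih =>
    match k with
    | 0 => simp
    | 1 => exact (Finset.card_filter_le _ _).trans (by simp)
    | k + 2 =>
      have hsub : (Finset.Ico a (a + (k + 2))).filter P ⊆
          ((Finset.Ico a (a + 2)).filter P) ∪ ((Finset.Ico (a + 2) (a + 2 + k)).filter P) := by
        intro i hi
        simp only [Finset.mem_union, Finset.mem_filter, Finset.mem_Ico] at hi ⊢
        rcases Nat.lt_or_ge i (a + 2) with h | h
        · exact Or.inl ⟨⟨hi.1.1, h⟩, hi.2⟩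
        · exact Or.inr ⟨⟨h, by omega⟩, hi.2⟩
      have h1 : ((Finset.Ico a (a + 2)).filter P).card ≤ 1 := by
        rw [Finset.card_le_one]
        intro i hi j hj
        simp only [Finset.mem_filter, Finset.mem_Ico] at hi hj
        by_contra hne
        rcases Nat.lt_or_gt_of_ne hne with h | h
        · obtain rfl : j = i + 1 := by omega
          exact hP i hi.2 hj.2
        · obtain rfl : i = j + 1 := by omega
          exact hP j hj.2 hi.2
      have h2 := ih k (by omega) (a + 2)
      have h3 := (Finset.card_le_card hsub).trans (Finset.card_union_le _ _)
      omega

/-- On an odd cycle some gap in a nonempty cyclically arranged set is odd. -/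
theorem exists_odd_gap {P : ℕ → Prop} {m : ℕ} (hm : Odd m) (hper : ∀ i, P (i + m) ↔ P i)
    {i j : ℕ} (hi : P i) (hj : P j) (hij : i < j) (hji : j < i + m) :
    ∃ s p, Even p ∧ 0 < p ∧ p < m ∧ P s ∧ P (s + p) ∧ ∀ t, p < t → t < m → ¬ P (s + t) := by
  classical
  -- Take the first odd offset `k` in `P` and the last offset `l` in `P` before it. Then `l` is
  -- even, so the gap between them is odd, and its complement in the period is the even `p`.
  have hex : ∃ k, Odd k ∧ P (i + k) := ⟨m, hm, (hper i).2 hi⟩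
  obtain ⟨hk, hPk⟩ := Nat.find_spec hex
  have hmin : ∀ l < Nat.find hex, Odd l → ¬ P (i + l) := fun l hl ho hPl =>
    Nat.find_min hex hl ⟨ho, hPl⟩
  have hkm : Nat.find hex ≤ m := Nat.find_min' hex ⟨hm, (hper i).2 hi⟩
  generalize Nat.find hex = k at hk hPk hmin hkm
  have hk0 : 0 < k := hk.pos
  set l := Nat.findGreatest (fun l => P (i + l)) (k - 1) with hl
  have hPl : P (i + l) := Nat.findGreatest_spec (P := fun l => P (i + l)) (Nat.zero_le _) hi
  have hlk : l ≤ k - 1 := Nat.findGreatest_le _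
  have hgap : ∀ t, l < t → t < k → ¬ P (i + t) := fun t h1 h2 =>
    Nat.findGreatest_is_greatest (P := fun l => P (i + l)) h1 (by omega)
  have hle : Even l := by
    by_contra h
    exact hmin l (by omega) (Nat.not_even_iff_odd.1 h) hPl
  refine ⟨i + k, l + m - k, ?_, ?_, by omega, hPk, ?_, ?_⟩
  · rw [Nat.even_sub (by omega)]
    exact iff_of_false (Nat.not_even_iff_odd.2 (hle.add_odd hm)) (Nat.not_even_iff_odd.2 hk)
  -- If `p = 0`, the gap would be the whole period, but `j` lies strictly inside it.
  · by_contra h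
    refine hgap (j - i) (by omega) (by omega) ?_
    rwa [Nat.add_sub_cancel' hij.le]
  · rw [show i + k + (l + m - k) = i + l + m by omega, hper]
    exact hPl
  · intro t h1 h2 h3
    rw [show i + k + t = i + (k + t - m) + m by omega, hper] at h3
    exact hgap _ (by omega) (by omega) h3

/-! ### Prism-Hamiltonicity from a dominating longest cycle -/

namespace IsLongestCycle

variable {c : ℕ → V} {m : ℕ}

theorem injOn (hc : G.IsLongestCycle c m) : Set.InjOn c {i | i < m} := by
  intro i hi j hj hij
  have hi' : i < m := hi
  have hj' : j < m := hj
  by_contra hne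
  rcases Nat.lt_or_gt_of_ne hne with h | h
  · exact hc.inj i j h (by omega) hij
  · exact hc.inj j i h (by omega) hij.symm

theorem card_image (hc : G.IsLongestCycle c m) [DecidableEq V] {I : Finset ℕ}
    (hI : ∀ i ∈ I, i < m) : (I.image c).card = I.card :=
  Finset.card_image_of_injOn fun i hi j hj hij => hc.injOn (hI i hi) (hI j hj) hij

theorem not_adj_consecutive (hc : G.IsLongestCycle c m) {x : V} (hx : ∀ i, c i ≠ x) (i : ℕ)
    (h : G.Adj x (c i)) : ¬ G.Adj x (c (i + 1)) := fun h' =>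
  hc.not_insert (IsListWalk.singleton x) (List.nodup_singleton x)
    (by simpa using hx) h.symm h'

/-- Parity plays no role here: the closed walk is the single edge from `c 0` to `c 1`, and the rest
of the cycle hangs at `c 1` as one path. -/
theorem isPrismHamiltonian_of_spanning [Fintype V] [DecidableEq V]
    (hc : G.IsLongestCycle c m) (h : ∀ v, ∃ i, c i = v) : G.IsPrismHamiltonian := by
  have hm := hc.two_le
  have h01 : c 0 ≠ c 1 := hc.inj 0 1 (by omega) (by omega)
  have h1 : ∀ z ∈ seg c 2 (m - 2), z ≠ c 0 ∧ z ≠ c 1 := by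
    intro z hz
    obtain ⟨i, h2, h3, rfl⟩ := mem_seg.1 hz
    exact ⟨(hc.inj 0 i (by omega) (by omega)).symm, (hc.inj 1 i (by omega) (by omega)).symm⟩
  refine isPrismHamiltonian_of_hung_paths (L := [c 0, c 1])
    (F := fun v => if v = c 1 then seg c 2 (m - 2) else [])
    ((IsListWalk.singleton (c 1)).cons (hc.adj 0)) (hc.adj 0).symm (by simpa using h01)
    (by simp) ?_ ?_ ?_ ?_ ?_
  · intro v hv
    split_ifs with h
    · subst h
      rw [← seg_succ]
      exact (hc.walk_seg (a := 1) (b := m - 2 + 1) (by omega) (by omega)).chain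
    · simp
  · intro v hv
    split_ifs with h
    · exact hc.nodup_seg (by omega)
    · simp
  · intro v hv z hz
    split_ifs at hz with h
    · simpa using h1 z hz
    · simp at hz
  · intro v _ w _ z hz hz'
    split_ifs at hz hz' with h h'
    · exact h.trans h'.symm
    · simp at hz'
    · simp at hz
    · simp at hz
  · intro z
    obtain ⟨i, rfl⟩ := h z
    obtain ⟨j, hj, hji⟩ := hc.exists_lt i
    rw [← hji]
    rcases (by omega : j = 0 ∨ j = 1 ∨ 2 ≤ j) with rfl | rfl | h
    · simp
    · simp
    · right
      refine ⟨c 1, by simp, ?_⟩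
      rw [if_pos rfl, mem_seg]
      exact ⟨j, h, by omega, rfl⟩

/-- The neighbourhood of `x` separates it from some vertex of the cycle. -/
theorem three_le_degree_of_off [Fintype V] [DecidableEq V] [DecidableRel G.Adj]
    (hc : G.IsLongestCycle c m) {β : ℝ} (h : G.IsTough β) (hβ : 1 < β) {x : V}
    (hx : ∀ i, c i ≠ x) : 3 ≤ G.degree x := by
  obtain ⟨i, hi⟩ : ∃ i, ¬ G.Adj x (c i) := by
    by_contra! hno
    exact hc.not_adj_consecutive hx 0 (hno 0) (hno 1)
  rw [← card_neighborFinset_eq_degree]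
  refine h.three_le_card hβ (K := {x}) (k := x) (z := c i) rfl (by simp) (hx i) (by simpa using hi)
    fun a b ha _ hab => Or.inr ?_
  rw [Set.mem_singleton_iff] at ha
  simpa [ha] using hab

theorem degree_le_of_dominating [Fintype V] [DecidableEq V] [DecidableRel G.Adj]
    (hc : G.IsLongestCycle c m) (hdom : ∀ x y, (∀ i, c i ≠ x) → (∀ i, c i ≠ y) → ¬ G.Adj x y)
    {I : Finset ℕ} {x : V} (hI : ∀ i < m, ∃ j ∈ I, c j = c i) (hx : ∀ i, c i ≠ x) :
    G.degree x ≤ (I.filter fun i => G.Adj x (c i)).card := by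
  have h1 := degree_le_of_indices (G := G) hI x
  have h2 : (((Finset.range m).image c)ᶜ.filter fun y => G.Adj x y) = ∅ := by
    rw [Finset.filter_eq_empty_iff]
    exact fun y hy => hdom x y hx (hc.mem_compl_image.1 hy)
  rwa [h2, Finset.card_empty, add_zero] at h1

theorem degree_le_half [Fintype V] [DecidableEq V] [DecidableRel G.Adj]
    (hc : G.IsLongestCycle c m) (hdom : ∀ x y, (∀ i, c i ≠ x) → (∀ i, c i ≠ y) → ¬ G.Adj x y)
    {x : V} (hx : ∀ i, c i ≠ x) : G.degree x ≤ (m + 1) / 2 := by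
  have h1 := hc.degree_le_of_dominating hdom (I := Finset.Ico 0 (0 + m))
    (fun i hi => ⟨i, by simpa using hi, rfl⟩) hx
  exact h1.trans (card_filter_Ico_le_of_not_consecutive (hc.not_adj_consecutive hx) 0 m)

theorem isPrismHamiltonian_of_even [Fintype V] [DecidableEq V] [DecidableRel G.Adj]
    (hc : G.IsLongestCycle c m) (hm : Even m)
    (hdom : ∀ x y, (∀ i, c i ≠ x) → (∀ i, c i ≠ y) → ¬ G.Adj x y)
    (h3 : ∀ x, (∀ i, c i ≠ x) → 3 ≤ G.degree x)
    (hdeg : ((Fintype.card V + 2 : ℕ) : ℕ∞) ≤ G.deltaThree) : G.IsPrismHamiltonian := by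
  have h2 := hc.two_le
  have hcard := hc.card_compl_image
  set R := ((Finset.range m).image c)ᶜ with hR
  have hoff : ∀ y, y ∈ R ↔ ∀ i, c i ≠ y := fun y => hc.mem_compl_image
  have hRdeg : ∀ y ∈ R, R.card ≤ G.degree y := by
    intro y hy
    by_contra! hlt
    have hy3 := h3 y ((hoff y).1 hy)
    obtain ⟨x, hx, z, hz, hxz⟩ := Finset.one_lt_card.1
      (show 1 < (R.erase y).card by rw [Finset.card_erase_of_mem hy]; omega)
    obtain ⟨hxy, hx⟩ := Finset.mem_erase.1 hx
    obtain ⟨hzy, hz⟩ := Finset.mem_erase.1 hz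
    rw [hoff] at hx hy hz
    -- For even `m` the degrees of `x` and `z` are at most `m / 2`, so `y` retains degree at least
    -- `n + 2 - m = R.card + 2`.
    have := le_degree_add_degree_add_degree hdeg hxy hxz hzy.symm (hdom _ _ hx hy) (hdom _ _ hx hz)
      (hdom _ _ hy hz)
    have := hc.degree_le_half hdom hx
    have := hc.degree_le_half hdom hz
    obtain ⟨k, hk⟩ := hm
    omega
  obtain ⟨f, hf, hfN⟩ := exists_injOn_mem_of_card_le (T := R) (t := fun y => G.neighborFinset y)
    (by simpa using hRdeg)
  simp only [mem_neighborFinset] at hfN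
  have hL := hc.walk_seg (a := 0) (b := m - 1) (k := m) (by omega) (by omega)
  have hmemL : ∀ i, c i ∈ seg c 0 m := by
    intro i
    obtain ⟨j, hj, hji⟩ := hc.exists_lt i
    exact mem_seg.2 ⟨j, by omega, by omega, hji⟩
  have hon : ∀ z, z ∈ R ∨ ∃ i, c i = z := by
    intro z
    by_cases h : ∃ i, c i = z
    · exact Or.inr h
    · exact Or.inl ((hoff z).2 (not_exists.1 h))
  refine isPrismHamiltonian_of_matching hL ?_ (hc.nodup_seg le_rfl) (by simpa using hm)
    (F := fun _ => []) (by simp) (by simp) (by simp) (by simp) hf (by simp)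
    (fun y hy => (hfN y hy).symm) ?_ (by simp) ?_
  · have := hc.adj (m - 1)
    rwa [Nat.sub_add_cancel (by omega), show c m = c 0 by simpa using hc.periodic 0] at this
  · intro y hy hyL
    obtain ⟨i, -, -, hi⟩ := mem_seg.1 hyL
    exact (hoff y).1 hy i hi
  · intro z
    rcases hon z with hz | ⟨i, rfl⟩
    · refine Or.inr (Or.inr ⟨hz, ?_⟩)
      rcases hon (f z) with h | ⟨i, hi⟩
      · exact absurd (hfN z hz) (hdom _ _ ((hoff z).1 hz) ((hoff _).1 h))
      · rw [← hi]
        exact hmemL i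
    · exact Or.inl (hmemL i)

/-- The even cycle `x, c 0, …, c p` is used as the closed walk; the remaining part of `c` is cut
after `c t` into two paths hanging at `c p` and `c 0`, the former of which is extended by `E`. -/
theorem isPrismHamiltonian_of_cut [Fintype V] [DecidableEq V] (hc : G.IsLongestCycle c m) {x : V}
    (hx : ∀ i, c i ≠ x) {p t : ℕ} (hp : Even p) (hp0 : 0 < p) (hpt : p ≤ t) (htm : t < m)
    (hx0 : G.Adj x (c 0)) (hxp : G.Adj x (c p)) {E : List V} (hE : (c t :: E).IsChain G.Adj)
    (hEn : E.Nodup) (hEx : x ∉ E) (hEc : ∀ e ∈ E, ∀ i, c i ≠ e) {T : Finset V} {f : V → V}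
    (hf : Set.InjOn f T) (hfT : ∀ y ∈ T, ∃ i < p, c i = f y) (hadj : ∀ y ∈ T, G.Adj (f y) y)
    (hTx : x ∉ T) (hTc : ∀ y ∈ T, ∀ i, c i ≠ y) (hTE : ∀ y ∈ T, y ∉ E)
    (hTt : ∀ y ∈ T, t + 1 = m) (hcov : ∀ z, (∀ i, c i ≠ z) → z = x ∨ z ∈ E ∨ z ∈ T) :
    G.IsPrismHamiltonian := by
  have hm := hc.two_le
  have h0p : c 0 ≠ c p := hc.inj 0 p hp0 (by omega)
  have hL : G.IsListWalk (c 0) x (seg c 0 (p + 1) ++ [x]) :=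
    (hc.walk_seg (a := 0) (b := p) (by omega) (by omega)).concat hxp.symm
  have hmemL : ∀ v, v ∈ seg c 0 (p + 1) ++ [x] ↔ (∃ i ≤ p, c i = v) ∨ v = x := by
    intro v
    rw [List.mem_append, List.mem_singleton, mem_seg]
    simp
  have hcL : ∀ i, p < i → i < m → c i ∉ seg c 0 (p + 1) ++ [x] := by
    intro i h1 h2 h
    rcases (hmemL _).1 h with ⟨j, hj, hji⟩ | h
    · exact hc.inj j i (by omega) (by omega) hji
    · exact hx i h
  set F : V → List V := fun v => if v = c p then seg c (p + 1) (t - p) ++ E else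
    if v = c 0 then (seg c (t + 1) (m - 1 - t)).reverse else [] with hF
  have hFp : F (c p) = seg c (p + 1) (t - p) ++ E := by simp [hF]
  have hF0 : F (c 0) = (seg c (t + 1) (m - 1 - t)).reverse := by simp [hF, h0p]
  have hFv : ∀ v, v ≠ c p → v ≠ c 0 → F v = [] := fun v h h' => by simp [hF, h, h']
  have hFcases : ∀ v, v = c p ∨ v = c 0 ∨ F v = [] := by
    intro v
    by_cases h : v = c p
    · exact Or.inl h
    · by_cases h' : v = c 0
      · exact Or.inr (Or.inl h')
      · exact Or.inr (Or.inr (hFv v h h'))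
  have hmemp : ∀ z, z ∈ F (c p) ↔ (∃ i, p < i ∧ i ≤ t ∧ c i = z) ∨ z ∈ E := by
    intro z
    rw [hFp, List.mem_append, mem_seg, show p + 1 + (t - p) = t + 1 by omega]
    simp only [Nat.succ_le_iff, Nat.lt_succ_iff]
  have hmem0 : ∀ z, z ∈ F (c 0) ↔ ∃ i, t < i ∧ i < m ∧ c i = z := by
    intro z
    rw [hF0, List.mem_reverse, mem_seg, show t + 1 + (m - 1 - t) = m by omega]
    simp only [Nat.succ_le_iff]
  have hdisj : ∀ z, z ∈ F (c p) → z ∉ F (c 0) := by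
    intro z hz hz'
    obtain ⟨j, h1, h2, rfl⟩ := (hmem0 z).1 hz'
    rcases (hmemp _).1 hz with ⟨i, h3, h4, h5⟩ | h
    · exact hc.inj i j (by omega) (by omega) h5
    · exact hEc _ h j rfl
  refine isPrismHamiltonian_of_matching hL hx0 ?_ ?_ (F := F) ?_ ?_ ?_ ?_ hf ?_ hadj ?_ ?_ ?_
  · rw [List.nodup_append']
    refine ⟨hc.nodup_seg (by omega), List.nodup_singleton x, fun v hv hv' => ?_⟩
    obtain ⟨i, -, -, hi⟩ := mem_seg.1 hv
    exact hx i (hi.trans (List.mem_singleton.1 hv'))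
  · simpa [Nat.even_add_one] using hp
  · intro v hv
    rcases hFcases v with rfl | rfl | h
    · rw [hFp, ← List.cons_append, ← seg_succ]
      have h1 := hc.walk_seg (a := p) (b := t) (k := t - p + 1) (by omega) (by omega)
      refine h1.chain.append hE.tail fun a ha b hb => ?_
      rw [h1.last] at ha
      obtain rfl : c t = a := by simpa using ha
      exact hE.rel_head? hb
    · rw [hF0]
      refine List.IsChain.cons ?_ ?_
      · rcases Nat.eq_zero_or_pos (m - 1 - t) with h | h
        · simp [h, seg]
        · exact (hc.walk_seg (a := t + 1) (b := m - 1) (k := m - 1 - t) (by omega)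
            h).reverse.chain
      · intro y hy
        rcases Nat.eq_zero_or_pos (m - 1 - t) with h | h
        · simp [h, seg] at hy
        · rw [(hc.walk_seg (a := t + 1) (b := m - 1) (k := m - 1 - t) (by omega)
            h).reverse.head] at hy
          obtain rfl : c (m - 1) = y := by simpa using hy
          have := hc.adj (m - 1)
          rw [Nat.sub_add_cancel (by omega), show c m = c 0 by simpa using hc.periodic 0] at this
          exact this.symm
    · simp [h]
  · intro v hv
    rcases hFcases v with rfl | rfl | h
    · rw [hFp, List.nodup_append']
      refine ⟨hc.nodup_seg (by omega), hEn, fun z hz hz' => ?_⟩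
      obtain ⟨i, -, -, hi⟩ := mem_seg.1 hz
      exact hEc z hz' i hi
    · rw [hF0, List.nodup_reverse]
      exact hc.nodup_seg (by omega)
    · simp [h]
  · intro v hv z hz hzL
    rcases hFcases v with rfl | rfl | h
    · rcases (hmemp z).1 hz with ⟨i, h1, h2, rfl⟩ | h
      · exact hcL i h1 (by omega) hzL
      · rcases (hmemL z).1 hzL with ⟨i, -, hi⟩ | rfl
        · exact hEc z h i hi
        · exact hEx h
    · obtain ⟨i, h1, h2, rfl⟩ := (hmem0 z).1 hz
      exact hcL i (by omega) (by omega) hzL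
    · simp [h] at hz
  · intro v hv w hw z hz hz'
    rcases hFcases v with rfl | rfl | h
    · rcases hFcases w with rfl | rfl | h'
      · rfl
      · exact absurd hz' (hdisj z hz)
      · simp [h'] at hz'
    · rcases hFcases w with rfl | rfl | h'
      · exact absurd hz (hdisj z hz')
      · rfl
      · simp [h'] at hz'
    · simp [h] at hz
  · intro y hy
    obtain ⟨i, hi, hiy⟩ := hfT y hy
    rcases hFcases (f y) with h | h | h
    · exact absurd (hiy.trans h) (hc.inj i p hi (by omega))
    -- A vertex of `T` may hang at `c 0` only because then `t = m - 1`, which leaves no path there.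
    · rw [h, hF0, show m - 1 - t = 0 by have := hTt y hy; omega]
      rfl
    · exact h
  · intro y hy hyL
    rcases (hmemL y).1 hyL with ⟨i, -, hi⟩ | rfl
    · exact hTc y hy i hi
    · exact hTx hy
  · intro y hy v hv hyv
    rcases hFcases v with rfl | rfl | h
    · rcases (hmemp y).1 hyv with ⟨i, -, -, hi⟩ | h
      · exact hTc y hy i hi
      · exact hTE y hy h
    · obtain ⟨i, -, -, hi⟩ := (hmem0 y).1 hyv
      exact hTc y hy i hi
    · simp [h] at hyv
  · intro z
    have hpL : c p ∈ seg c 0 (p + 1) ++ [x] := (hmemL _).2 (Or.inl ⟨p, le_rfl, rfl⟩)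
    have h0L : c 0 ∈ seg c 0 (p + 1) ++ [x] := (hmemL _).2 (Or.inl ⟨0, by omega, rfl⟩)
    by_cases h : ∃ i, c i = z
    · obtain ⟨i, rfl⟩ := h
      obtain ⟨j, hj, hji⟩ := hc.exists_lt i
      rw [← hji]
      rcases le_or_gt j p with h1 | h1
      · exact Or.inl ((hmemL _).2 (Or.inl ⟨j, h1, rfl⟩))
      · rcases le_or_gt j t with h2 | h2
        · exact Or.inr (Or.inl ⟨c p, hpL, (hmemp _).2 (Or.inl ⟨j, h1, h2, rfl⟩)⟩)
        · exact Or.inr (Or.inl ⟨c 0, h0L, (hmem0 _).2 ⟨j, h2, hj, rfl⟩⟩)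
    · rcases hcov z (not_exists.1 h) with rfl | h | h
      · exact Or.inl ((hmemL _).2 (Or.inr rfl))
      · exact Or.inr (Or.inl ⟨c p, hpL, (hmemp _).2 (Or.inr h)⟩)
      · obtain ⟨i, hi, hiz⟩ := hfT z h
        exact Or.inr (Or.inr ⟨h, (hmemL _).2 (Or.inl ⟨i, hi.le, hiz⟩)⟩)

theorem isPrismHamiltonian_of_odd_gap [Fintype V] [DecidableEq V] [DecidableRel G.Adj]
    (hc : G.IsLongestCycle c m) (hm : Odd m)
    (hdom : ∀ x y, (∀ i, c i ≠ x) → (∀ i, c i ≠ y) → ¬ G.Adj x y)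
    (hdeg : ((Fintype.card V + 2 : ℕ) : ℕ∞) ≤ G.deltaThree)
    (h3 : ∀ x, (∀ i, c i ≠ x) → 3 ≤ G.degree x) {x : V} (hx : ∀ i, c i ≠ x) {p : ℕ}
    (hp : Even p) (hp0 : 0 < p) (hpm : p < m) (hx0 : G.Adj x (c 0)) (hxp : G.Adj x (c p))
    (hgap : ∀ t, p < t → t < m → ¬ G.Adj x (c t)) : G.IsPrismHamiltonian := by
  have hcard := hc.card_compl_image
  set R := ((Finset.range m).image c)ᶜ with hR
  have hoff : ∀ y, y ∈ R ↔ ∀ i, c i ≠ y := fun y => hc.mem_compl_image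
  have hxR : x ∈ R := (hoff x).2 hx
  have hTcard : (R.erase x).card + 1 = R.card := Finset.card_erase_add_one hxR
  have hcon : ∀ y, (∀ i, c i ≠ y) → G.degree y ≤
      ((Finset.range p).filter fun i => G.Adj y (c i)).card + (m - p + 1) / 2 := by
    intro y hy
    have h1 := hc.degree_le_of_dominating hdom (I := Finset.range p ∪ Finset.Ico p (p + (m - p)))
      (fun i hi => ⟨i, by rw [Finset.mem_union, Finset.mem_range, Finset.mem_Ico]; omega, rfl⟩) hy
    rw [Finset.filter_union] at h1
    have h2 := card_filter_Ico_le_of_not_consecutive (hc.not_adj_consecutive hy) p (m - p)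
    have h4 := Finset.card_union_le ((Finset.range p).filter fun i => G.Adj y (c i))
      ((Finset.Ico p (p + (m - p))).filter fun i => G.Adj y (c i))
    omega
  have hxdeg : G.degree x ≤ p / 2 + 1 := by
    have h1 := hc.degree_le_of_dominating hdom (I := Finset.range m)
      (fun i hi => ⟨i, Finset.mem_range.2 hi, rfl⟩) hx
    have h2 : (Finset.range m).filter (fun i => G.Adj x (c i)) ⊆
        (Finset.Ico 0 (0 + (p + 1))).filter fun i => G.Adj x (c i) := by
      intro i hi
      simp only [Finset.mem_filter, Finset.mem_range, Finset.mem_Ico] at hi ⊢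
      refine ⟨⟨by omega, ?_⟩, hi.2⟩
      by_contra h
      exact hgap i (by omega) hi.1 hi.2
    have h4 := card_filter_Ico_le_of_not_consecutive (hc.not_adj_consecutive hx) 0 (p + 1)
    have h5 := Finset.card_le_card h2
    omega
  -- Only `c 0, …, c (p - 1)` are available for matching, since the whole gap hangs at `c p`.
  by_cases hHall : ∀ y ∈ R.erase x, (R.erase x).card ≤
      (((Finset.range p).filter fun i => G.Adj y (c i)).image c).card
  · obtain ⟨f, hf, hft⟩ := exists_injOn_mem_of_card_le hHall
    have hft' : ∀ y ∈ R.erase x, ∃ i < p, c i = f y ∧ G.Adj y (c i) := by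
      intro y hy
      obtain ⟨i, hi, hiy⟩ := Finset.mem_image.1 (hft y hy)
      rw [Finset.mem_filter, Finset.mem_range] at hi
      exact ⟨i, hi.1, hiy, hi.2⟩
    refine hc.isPrismHamiltonian_of_cut hx hp hp0 (t := m - 1) (by omega) (by omega) hx0 hxp
      (E := []) (by simp) (by simp) (by simp) (by simp) hf ?_ ?_ (by simp) ?_ (by simp)
      (fun _ _ => by omega) ?_
    · intro y hy
      obtain ⟨i, hi, hiy, -⟩ := hft' y hy
      exact ⟨i, hi, hiy⟩
    · intro y hy
      obtain ⟨i, -, hiy, h⟩ := hft' y hy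
      exact hiy ▸ h.symm
    · exact fun y hy => (hoff y).1 (Finset.mem_of_mem_erase hy)
    · intro z hz
      by_cases h : z = x
      · exact Or.inl h
      · exact Or.inr (Or.inr (Finset.mem_erase.2 ⟨h, (hoff z).2 hz⟩))
  · push Not at hHall
    obtain ⟨y, hyT, hylt⟩ := hHall
    rw [hc.card_image (fun i hi => by
      have := Finset.mem_range.1 (Finset.mem_filter.1 hi).1
      omega)] at hylt
    obtain ⟨hyx, hyR⟩ := Finset.mem_erase.1 hyT
    have hy := (hoff y).1 hyR
    -- With a third vertex `z`, the bounds `p / 2 + 1`, `(m + 1) / 2` and `hcon` add up to `m + 2`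
    -- plus the number of neighbours of `y` before `c p`. That number would be at least `R.card`,
    -- against the failure of Hall's condition at `y`.
    have hT1 : ∀ z ∈ R.erase x, z = y := by
      by_contra! hno
      obtain ⟨z, hzT, hzy⟩ := hno
      obtain ⟨hzx, hzR⟩ := Finset.mem_erase.1 hzT
      have hz := (hoff z).1 hzR
      have h1 := le_degree_add_degree_add_degree hdeg hyx.symm hzx.symm hzy.symm (hdom _ _ hx hy)
        (hdom _ _ hx hz) (hdom _ _ hy hz)
      have h2 := hc.degree_le_half hdom hz
      have h4 := hcon y hy
      obtain ⟨k, hk⟩ := hm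
      obtain ⟨l, hl⟩ := hp
      omega
    have hT : (R.erase x).card = 1 := Finset.card_eq_one.2
      ⟨y, Finset.eq_singleton_iff_unique_mem.2 ⟨hyT, hT1⟩⟩
    rw [hT, Nat.lt_one_iff, Finset.card_eq_zero, Finset.filter_eq_empty_iff] at hylt
    obtain ⟨t, hpt, htm, hyt⟩ : ∃ t, p ≤ t ∧ t < m ∧ G.Adj y (c t) := by
      have h1 := hc.degree_le_of_dominating hdom (I := Finset.range m)
        (fun i hi => ⟨i, Finset.mem_range.2 hi, rfl⟩) hy
      have h2 := h3 y hy
      obtain ⟨t, ht⟩ := Finset.card_pos.1 (lt_of_lt_of_le (by omega) (h2.trans h1))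
      rw [Finset.mem_filter, Finset.mem_range] at ht
      refine ⟨t, ?_, ht.1, ht.2⟩
      by_contra! h
      exact hylt (Finset.mem_range.2 h) ht.2
    -- The gap is cut just after the neighbour `c t` of `y`, so that `y` ends the path hanging at `c
    -- p`.
    refine hc.isPrismHamiltonian_of_cut hx hp hp0 hpt htm hx0 hxp (E := [y]) (T := ∅) (f := id)
      (by simpa using hyt.symm) (by simp) (by simpa using hyx.symm) (by simpa using hy) (by simp)
      (by simp) (by simp) (by simp) (by simp) (by simp) (by simp) ?_
    intro z hz
    by_cases h : z = x
    · exact Or.inl h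
    · exact Or.inr (Or.inl (by simpa using hT1 z (Finset.mem_erase.2 ⟨h, (hoff z).2 hz⟩)))

end IsLongestCycle

end SimpleGraph

/-- The proof uses a longest cycle and does not need the chordality assumption. -/
theorem mainTheorem3 {V : Type*} [Fintype V] [DecidableEq V] (G : SimpleGraph V)
    [DecidableRel G.Adj] (hV : 2 ≤ Fintype.card V) (ε : ℝ) (hε : 0 < ε)
    (htough : G.IsTough (1 + ε)) (hchordal : G.IsKChordal 5)
    (hdeg : ((Fintype.card V + 2 : ℕ) : ℕ∞) ≤ G.deltaThree) :
    G.IsPrismHamiltonian := by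
  have hβ : 1 < 1 + ε := by linarith
  have : Nontrivial V := Fintype.one_lt_card_iff_nontrivial.1 hV
  obtain ⟨v, w, hvw⟩ := htough.exists_adj hβ
  obtain ⟨c, m, hc⟩ := SimpleGraph.exists_isLongestCycle hvw
  have hdom : ∀ x y, (∀ i, c i ≠ x) → (∀ i, c i ≠ y) → ¬ G.Adj x y :=
    fun x y hx hy => hc.not_adj_of_off htough hβ hdeg hx hy
  have h3 : ∀ x, (∀ i, c i ≠ x) → 3 ≤ G.degree x :=
    fun x hx => hc.three_le_degree_of_off htough hβ hx
  by_cases hspan : ∀ v, ∃ i, c i = v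
  · exact hc.isPrismHamiltonian_of_spanning hspan
  push Not at hspan
  obtain ⟨x, hx⟩ := hspan
  rcases Nat.even_or_odd m with hm | hm
  · exact hc.isPrismHamiltonian_of_even hm hdom h3 hdeg
  · have h1 := hc.degree_le_of_dominating hdom (I := Finset.range m)
      (fun i hi => ⟨i, Finset.mem_range.2 hi, rfl⟩) hx
    have h2 := h3 x hx
    obtain ⟨i, hi, j, hj, hij⟩ : ∃ i, G.Adj x (c i) ∧ ∃ j, G.Adj x (c j) ∧ i < j ∧ j < i + m := by
      obtain ⟨i, hi, j, hj, hij⟩ := Finset.one_lt_card.1 (lt_of_lt_of_le (by omega) h1)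
      rw [Finset.mem_filter, Finset.mem_range] at hi hj
      rcases Nat.lt_or_gt_of_ne hij with h | h
      · exact ⟨i, hi.2, j, hj.2, h, by omega⟩
      · exact ⟨j, hj.2, i, hi.2, h, by omega⟩
    obtain ⟨s, p, hp, hp0, hpm, hs, hsp, hgap⟩ :=
      SimpleGraph.exists_odd_gap (P := fun i => G.Adj x (c i)) hm (fun i => by rw [hc.periodic])
        hi hj hij.1 hij.2
    -- Rotating the cycle places the odd gap between `c p` and `c m = c 0`.
    have hcs := hc.shift s
    refine hcs.isPrismHamiltonian_of_odd_gap hm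
      (fun y z hy hz => hcs.not_adj_of_off htough hβ hdeg hy hz) hdeg
      (fun y hy => hcs.three_le_degree_of_off htough hβ hy) (fun i => hx _) hp hp0 hpm
      (by simpa using hs) (by simpa [add_comm] using hsp) fun t h1 h2 => ?_
    rw [add_comm]
    exact hgap t h1 h2
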